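/- Let $\mathbb{K}$ be any field, let $d \ge 4$, let $S = \mathbb{K}[x_1,\dots,x_d]$ with the standard grading, and let $I_\Gamma(d) \subseteq S$ be the ideal generated by the monomials $x_1x_3, x_1x_4, \dots, x_1x_{d-1}$ and by all squarefree cubic monomials $x_ix_jx_k$, $2 \le i<j<k \le d-1$. Then the graded $S$-module $S/I_\Gamma(d)$ is Cohen–Macaulay, that is, the length of its minimal graded free resolution equals its codimension (the minimal codimension of an associated prime), and its Hilbert series is $$\sum_{q \ge 0} \dim_{\mathbb{K}} (S/I_\Gamma(d))_q\, t^q = \frac{1 + (d-3)t + \binom{d-3}{2}t^2}{(1-t)^3}.$$ If moreover $d \ge 5$, then the Castelnuovo–Mumford regularity of $S/I_\Gamma(d)$, that is, the maximum of $j-i$ over all $(i,j)$ such that $S(-j)$ is a summand of the $i$-th module of the minimal graded free resolution, is two. -/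

import Mathlib

/-- A graded free resolution `⋯ → F₁ → F₀ → N → 0`, with all `Fᵢ` of finite rank, of a graded
module `N = ⨁ N_q` over the standard graded polynomial ring `S = 𝕜[x₁, …, xₙ]`; the graded pieces
of `N` are given as `𝒩 : ℕ → Submodule 𝕜 N`.
The module `Fᵢ = ⨁_{a ∈ ι i} S(-deg i a)` is free on the finite set `ι i`, and its basis element
`a` has degree `deg i a`. All maps are homogeneous of degree zero. -/
structure GradedFreeResolution {𝕜 : Type*} [Field 𝕜] {n : ℕ} {N : Type*} [AddCommGroup N]
    [Module 𝕜 N] [Module (MvPolynomial (Fin n) 𝕜) N] (𝒩 : ℕ → Submodule 𝕜 N) where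
  /-- the basis of `Fᵢ` -/
  ι : ℕ → Type
  finite_ι : ∀ i, Finite (ι i)
  /-- the degrees of the basis elements -/
  deg : ∀ i, ι i → ℕ
  /-- the map `F₀ → N` -/
  aug : (ι 0 →₀ MvPolynomial (Fin n) 𝕜) →ₗ[MvPolynomial (Fin n) 𝕜] N
  /-- the map `F_{i+1} → F_i` -/
  d : ∀ i, (ι (i + 1) →₀ MvPolynomial (Fin n) 𝕜) →ₗ[MvPolynomial (Fin n) 𝕜]
    (ι i →₀ MvPolynomial (Fin n) 𝕜)
  aug_homogeneous : ∀ a, aug (Finsupp.single a 1) ∈ 𝒩 (deg 0 a)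
  /-- the `b`-coordinate of the image of the basis element `a` is zero or homogeneous of degree
  `deg a - deg b` -/
  d_homogeneous : ∀ i (a : ι (i + 1)) (b : ι i), ∀ s ∈ (d i (Finsupp.single a 1) b).support,
    s.degree + deg i b = deg (i + 1) a
  aug_surjective : Function.Surjective aug
  exact_zero : Function.Exact (d 0) aug
  exact_succ : ∀ i, Function.Exact (d (i + 1)) (d i)

namespace GradedFreeResolution

variable {𝕜 : Type*} [Field 𝕜] {n : ℕ} {N : Type*} [AddCommGroup N]
    [Module 𝕜 N] [Module (MvPolynomial (Fin n) 𝕜) N] {𝒩 : ℕ → Submodule 𝕜 N}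

/-- The resolution is minimal: `im (F_{i+1} → F_i) ⊆ 𝔪 F_i` for all `i`, `𝔪 = ⟨x₁, …, xₙ⟩`. -/
def IsMinimal (F : GradedFreeResolution (n := n) 𝒩) : Prop :=
  ∀ i, LinearMap.range (F.d i) ≤
    Ideal.span (Set.range (MvPolynomial.X : Fin n → MvPolynomial (Fin n) 𝕜)) •
      (⊤ : Submodule (MvPolynomial (Fin n) 𝕜) (F.ι i →₀ MvPolynomial (Fin n) 𝕜))

/-- The number `a_{i,j}` of summands `S(-j)` in `F_i`. -/
noncomputable def betti (F : GradedFreeResolution (n := n) 𝒩) (i j : ℕ) : ℕ :=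
  Nat.card {a : F.ι i // F.deg i a = j}

end GradedFreeResolution

/-- The Castelnuovo-Mumford regularity of the finitely generated graded module `N` is `r`:
`r = max {j - i | a_{i,j} ≠ 0}` for the graded Betti numbers `a_{i,j}` of a minimal graded free
resolution of `N` (these do not depend on the minimal resolution). -/
def HasRegularity {𝕜 : Type*} [Field 𝕜] (n : ℕ) {N : Type*} [AddCommGroup N]
    [Module 𝕜 N] [Module (MvPolynomial (Fin n) 𝕜) N] (𝒩 : ℕ → Submodule 𝕜 N) (r : ℤ) : Prop :=
  ∃ F : GradedFreeResolution (n := n) 𝒩, F.IsMinimal ∧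
    IsGreatest {m : ℤ | ∃ i j : ℕ, F.betti i j ≠ 0 ∧ m = (j : ℤ) - i} r

/-- The projective dimension of the finitely generated graded module `N` is `p`: a minimal graded
free resolution of `N` has length `p`. -/
def HasProjDim {𝕜 : Type*} [Field 𝕜] (n : ℕ) {N : Type*} [AddCommGroup N]
    [Module 𝕜 N] [Module (MvPolynomial (Fin n) 𝕜) N] (𝒩 : ℕ → Submodule 𝕜 N) (p : ℕ) : Prop :=
  ∃ F : GradedFreeResolution (n := n) 𝒩, F.IsMinimal ∧ IsGreatest {i : ℕ | Nonempty (F.ι i)} p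

/-- The codimension of a module: the least codimension (height) of an associated prime. -/
noncomputable def moduleCodim (R N : Type*) [CommRing R] [AddCommGroup N] [Module R N] : ℕ∞ :=
  ⨅ P ∈ associatedPrimes R N, P.height

/-- The finitely generated graded module `N` is Cohen-Macaulay: its projective dimension is equal
to its codimension. -/
def IsGradedCohenMacaulay {𝕜 : Type*} [Field 𝕜] (n : ℕ) {N : Type*} [AddCommGroup N]
    [Module 𝕜 N] [Module (MvPolynomial (Fin n) 𝕜) N] (𝒩 : ℕ → Submodule 𝕜 N) : Prop :=
  ∃ p : ℕ, HasProjDim n 𝒩 p ∧ moduleCodim (MvPolynomial (Fin n) 𝕜) N = p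

/-- The Hilbert series `∑ dim N_q t^q`. -/
noncomputable def gradedHilbertSeries {𝕜 : Type*} [Field 𝕜] {N : Type*} [AddCommGroup N]
    [Module 𝕜 N] (𝒩 : ℕ → Submodule 𝕜 N) : PowerSeries ℤ :=
  PowerSeries.mk fun q => (Module.finrank 𝕜 (𝒩 q) : ℤ)

/-- The grading of `S ⧸ I` for a homogeneous ideal `I`: the piece of degree `q` is the image of the
space of forms of degree `q`. -/
noncomputable def quotientPiece {𝕜 : Type*} [Field 𝕜] {n : ℕ}
    (I : Ideal (MvPolynomial (Fin n) 𝕜)) (q : ℕ) : Submodule 𝕜 (MvPolynomial (Fin n) 𝕜 ⧸ I) :=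
  (MvPolynomial.homogeneousSubmodule (Fin n) 𝕜 q).map (Ideal.Quotient.mkₐ 𝕜 I).toLinearMap

/-- The ideal `I_Γ(d) ⊆ 𝕜[x₁, …, x_d]` generated by `x₁x₃, …, x₁x_{d-1}` and all squarefree cubic
monomials in `x₂, …, x_{d-1}`. The variable `x_{i+1}` is `X i`, for `i = 0, …, d - 1`. -/
noncomputable def gammaIdeal (𝕜 : Type*) [Field 𝕜] (d : ℕ) : Ideal (MvPolynomial (Fin d) 𝕜) :=
  Ideal.span
    ({f | ∃ i j : Fin d, (i : ℕ) = 0 ∧ 2 ≤ (j : ℕ) ∧ (j : ℕ) + 2 ≤ d ∧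
        f = MvPolynomial.X i * MvPolynomial.X j} ∪
      {f | ∃ i j k : Fin d, 1 ≤ (i : ℕ) ∧ i < j ∧ j < k ∧ (k : ℕ) + 2 ≤ d ∧
        f = MvPolynomial.X i * MvPolynomial.X j * MvPolynomial.X k})

/-! The ideal has linear quotients: its generators can be added one at a time so that each colon
ideal `I : u` is generated by variables. The exact sequence `0 → (S/(I : u))(-deg u) → S/I → S/(I +
(u)) → 0` then turns resolutions of the first two terms, the first being a Koszul complex, into a
mapping cone resolving the third. The cone is minimal for degree reasons: basis elements of the
Koszul part in step `i` have degree `i + deg u`, while those of the resolution of `S/I` have degree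
at most `i + deg u - 1`, so the comparison map has no unit entries
(`IsMinimalOfType.exists_cokernel`).

Write `d = m + 4`. The quadrics come first; together they give length `m + 1`. The cubics follow in
colexicographic order (`isVariableColon_gammaCubics`). Their colon ideals need at most `m`
variables, so the length stays `m + 1`, and the regularity is two once a cubic exists.

For the codimension, the colon ideal by `x₁x₂` is the prime `(x₃, …, x_{d-1})` of height `m + 1`, so
it is associated. Conversely, a prime containing the ideal either contains all of `x₃, …, x_{d-1}`,
or contains `x₁` and all but at most two of `x₂, …, x_{d-1}`; both give height at least `m + 1`.

For the Hilbert series, the ideal is enlarged to `(x₃, …, x_{d-1})` by adding the products of two of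
these variables and then the variables themselves. Each colon ideal is generated by `d - 3`
variables, so the steps contribute `binom(d-3, 2) t² / (1-t)³`, `(d-3) t / (1-t)³` and finally `1 /
(1-t)³`. -/

open MvPolynomial

/-! ### Graded free modules and homogeneous maps -/

section FreeGraded

variable {𝕜 : Type*} [Field 𝕜] {n : ℕ} {κ κ' : Type*}

/-- The piece of degree `q` of the graded free module with a basis in degrees `deg`. -/
def freePiece (𝕜 : Type*) [Field 𝕜] (n : ℕ) {κ : Type*} (deg : κ → ℕ) (q : ℕ) :
    Submodule 𝕜 (κ →₀ MvPolynomial (Fin n) 𝕜) where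
  carrier := {x | ∀ b, ∀ s, coeff s (x b) ≠ 0 → s.degree + deg b = q}
  add_mem' {x y} hx hy b s hs := by
    by_cases h : coeff s (x b) = 0
    · refine hy b s fun h' => hs ?_
      simp [h, h']
    · exact hx b s h
  zero_mem' b s hs := by simp at hs
  smul_mem' c x hx b s hs := hx b s fun h => hs (by simp [h])

/-- The condition on `p` is homogeneity of degree `q - r`, written without subtraction. It is what
membership in `freePiece` says of a coordinate over a basis element of degree `r`. -/
theorem mul_mem_freePiece {deg : κ → ℕ} {q r : ℕ} {x : κ →₀ MvPolynomial (Fin n) 𝕜}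
    {p : MvPolynomial (Fin n) 𝕜} (hp : ∀ s, coeff s p ≠ 0 → s.degree + r = q) {e : ℕ}
    (hx : x ∈ freePiece 𝕜 n deg (r + e)) : p • x ∈ freePiece 𝕜 n deg (q + e) := by
  intro b s hs
  rw [Finsupp.smul_apply, smul_eq_mul, coeff_mul] at hs
  obtain ⟨⟨u, v⟩, huv, h⟩ := Finset.exists_ne_zero_of_sum_ne_zero hs
  rw [Finset.HasAntidiagonal.mem_antidiagonal] at huv
  have h1 := hp u (left_ne_zero_of_mul h)
  have h2 := hx b v (right_ne_zero_of_mul h)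
  simp only at huv
  rw [← huv, map_add]
  omega

theorem map_mem_freePiece {deg : κ → ℕ} {deg' : κ' → ℕ} {e : ℕ}
    {D : (κ →₀ MvPolynomial (Fin n) 𝕜) →ₗ[MvPolynomial (Fin n) 𝕜]
      (κ' →₀ MvPolynomial (Fin n) 𝕜)}
    (hD : ∀ a, D (Finsupp.single a 1) ∈ freePiece 𝕜 n deg' (deg a + e)) {q : ℕ}
    {x : κ →₀ MvPolynomial (Fin n) 𝕜} (hx : x ∈ freePiece 𝕜 n deg q) :
    D x ∈ freePiece 𝕜 n deg' (q + e) := by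
  classical
  rw [← Finsupp.sum_single x, Finsupp.sum, map_sum]
  refine Submodule.sum_mem _ fun a _ => ?_
  rw [← mul_one (x a), ← smul_eq_mul, ← Finsupp.smul_single, map_smul]
  exact mul_mem_freePiece (hx a) (hD a)

/-- The projection to the piece of degree `q` of a graded free module. -/
noncomputable def freeComponent (𝕜 : Type*) [Field 𝕜] (n : ℕ) {κ : Type*} (deg : κ → ℕ) (q : ℕ) :
    (κ →₀ MvPolynomial (Fin n) 𝕜) →ₗ[𝕜] (κ →₀ MvPolynomial (Fin n) 𝕜) :=
  Finsupp.lsum 𝕜 fun b => Finsupp.lsingle b ∘ₗ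
    (if deg b ≤ q then homogeneousComponent (q - deg b) else 0)

theorem coeff_freeComponent (deg : κ → ℕ) (q : ℕ) (x : κ →₀ MvPolynomial (Fin n) 𝕜)
    (b : κ) (s : Fin n →₀ ℕ) :
    coeff s (freeComponent 𝕜 n deg q x b) =
      if s.degree + deg b = q then coeff s (x b) else 0 := by
  classical
  induction x using Finsupp.induction_linear with
  | zero => simp
  | add x y hx hy =>
    simp only [map_add, Finsupp.add_apply, coeff_add, hx, hy]
    split_ifs <;> simp
  | single a p =>
    rw [freeComponent, Finsupp.lsum_single]
    by_cases hab : a = b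
    · subst hab
      by_cases hq : deg a ≤ q
      · simp only [if_pos hq, LinearMap.comp_apply, Finsupp.lsingle_apply,
          Finsupp.single_eq_same, coeff_homogeneousComponent]
        congr 1
        exact propext ⟨fun h => by omega, fun h => by omega⟩
      · rw [if_neg hq, if_neg (by omega)]
        simp
    · simp [hab]

theorem freeComponent_mem (deg : κ → ℕ) (q : ℕ) (x : κ →₀ MvPolynomial (Fin n) 𝕜) :
    freeComponent 𝕜 n deg q x ∈ freePiece 𝕜 n deg q := by
  intro b s hs
  rw [coeff_freeComponent] at hs
  by_contra h
  exact hs (if_neg h)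

theorem freeComponent_of_mem {deg : κ → ℕ} {q r : ℕ} {x : κ →₀ MvPolynomial (Fin n) 𝕜}
    (hx : x ∈ freePiece 𝕜 n deg r) :
    freeComponent 𝕜 n deg q x = if r = q then x else 0 := by
  ext b s
  rw [coeff_freeComponent]
  by_cases h : coeff s (x b) = 0
  · split_ifs <;> simp [h]
  · rw [hx b s h]
    split_ifs <;> simp

theorem single_monomial_mem_freePiece (deg : κ → ℕ) (a : κ) (s : Fin n →₀ ℕ) (c : 𝕜) :
    Finsupp.single a (monomial s c) ∈ freePiece 𝕜 n deg (s.degree + deg a) := by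
  classical
  intro b t ht
  rw [Finsupp.single_apply] at ht
  split_ifs at ht with hab
  · rw [coeff_monomial] at ht
    split_ifs at ht with hst
    · rw [hst, hab]
    · simp at ht
  · simp at ht

theorem map_freeComponent {deg : κ → ℕ} {deg' : κ' → ℕ}
    {D : (κ →₀ MvPolynomial (Fin n) 𝕜) →ₗ[MvPolynomial (Fin n) 𝕜]
      (κ' →₀ MvPolynomial (Fin n) 𝕜)}
    (hD : ∀ a, D (Finsupp.single a 1) ∈ freePiece 𝕜 n deg' (deg a)) (q : ℕ)
    (x : κ →₀ MvPolynomial (Fin n) 𝕜) :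
    D (freeComponent 𝕜 n deg q x) = freeComponent 𝕜 n deg' q (D x) := by
  induction x using Finsupp.induction_linear with
  | zero => simp
  | add x y hx hy => simp only [map_add, hx, hy]
  | single a p =>
    induction p using MvPolynomial.induction_on' with
    | monomial s c =>
      have h := single_monomial_mem_freePiece (𝕜 := 𝕜) deg a s c
      rw [freeComponent_of_mem h, freeComponent_of_mem (map_mem_freePiece (e := 0) hD h), add_zero]
      split_ifs <;> simp
    | add p r hp hr => simp only [Finsupp.single_add, map_add, hp, hr]

/-- A homogeneous map commutes with taking components, so the component of degree `q` of any
preimage is again a preimage. -/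
theorem exists_mem_freePiece_map_eq {deg : κ → ℕ} {deg' : κ' → ℕ}
    {D : (κ →₀ MvPolynomial (Fin n) 𝕜) →ₗ[MvPolynomial (Fin n) 𝕜]
      (κ' →₀ MvPolynomial (Fin n) 𝕜)}
    (hD : ∀ a, D (Finsupp.single a 1) ∈ freePiece 𝕜 n deg' (deg a)) {q : ℕ}
    {y : κ' →₀ MvPolynomial (Fin n) 𝕜} (hy : y ∈ freePiece 𝕜 n deg' q)
    (hr : y ∈ LinearMap.range D) : ∃ x ∈ freePiece 𝕜 n deg q, D x = y := by
  obtain ⟨x, rfl⟩ := hr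
  refine ⟨freeComponent 𝕜 n deg q x, freeComponent_mem _ _ _, ?_⟩
  rw [map_freeComponent hD, freeComponent_of_mem hy, if_pos rfl]

theorem mem_span_range_X {p : MvPolynomial (Fin n) 𝕜}
    (hp : ∀ s, coeff s p ≠ 0 → s.degree ≠ 0) :
    p ∈ Ideal.span (Set.range (X : Fin n → MvPolynomial (Fin n) 𝕜)) := by
  rw [← Set.image_univ, mem_ideal_span_X_image]
  intro s hs
  have h := hp s (mem_support_iff.1 hs)
  by_contra! h'
  refine h ?_
  rw [Finsupp.degree_eq_zero_iff]
  ext i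
  exact h' i trivial

end FreeGraded

/-! ### Comparison maps between graded resolutions -/

namespace GradedFreeResolution

variable {𝕜 : Type*} [Field 𝕜] {n : ℕ}
  {A : Type*} [AddCommGroup A] [Module 𝕜 A] [Module (MvPolynomial (Fin n) 𝕜) A]
  {B : Type*} [AddCommGroup B] [Module 𝕜 B] [Module (MvPolynomial (Fin n) 𝕜) B]
  {C : Type*} [AddCommGroup C] [Module 𝕜 C] [Module (MvPolynomial (Fin n) 𝕜) C]
  {𝒜 : ℕ → Submodule 𝕜 A} {ℬ : ℕ → Submodule 𝕜 B} {𝒞 : ℕ → Submodule 𝕜 C}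

theorem d_single_mem (F : GradedFreeResolution (n := n) ℬ) (i : ℕ) (a : F.ι (i + 1)) :
    F.d i (Finsupp.single a 1) ∈ freePiece 𝕜 n (F.deg i) (F.deg (i + 1) a) :=
  fun b s hs => F.d_homogeneous i a b s (mem_support_iff.2 hs)

/-- Every homogeneous element lifts to a homogeneous element of `F₀` of the same degree. -/
def LiftsHomogeneous (F : GradedFreeResolution (n := n) ℬ) : Prop :=
  ∀ q, ∀ x ∈ ℬ q, ∃ y ∈ freePiece 𝕜 n (F.deg 0) q, F.aug y = x

/-- A map out of a free module is a free choice on the basis; `P` records the commutation relation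
wanted on basis elements. -/
theorem exists_linearMap_of_basis {κ κ' : Type*} {deg : κ → ℕ} {deg' : κ' → ℕ} {e : ℕ}
    {P : κ → (κ' →₀ MvPolynomial (Fin n) 𝕜) → Prop}
    (h : ∀ a, ∃ y ∈ freePiece 𝕜 n deg' (deg a + e), P a y) :
    ∃ φ : (κ →₀ MvPolynomial (Fin n) 𝕜) →ₗ[MvPolynomial (Fin n) 𝕜]
      (κ' →₀ MvPolynomial (Fin n) 𝕜),
      (∀ a, φ (Finsupp.single a 1) ∈ freePiece 𝕜 n deg' (deg a + e)) ∧
        ∀ a, P a (φ (Finsupp.single a 1)) := by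
  choose y hy hP using h
  refine ⟨Finsupp.linearCombination _ y, fun a => ?_, fun a => ?_⟩ <;>
  simp [hy, hP]

/-- A homogeneous map of degree `e` lifts to a chain map of resolutions. -/
theorem exists_chainMap (G : GradedFreeResolution (n := n) 𝒜) (F : GradedFreeResolution (n := n) ℬ)
    (hF : F.LiftsHomogeneous) (e : ℕ) (μ : A →ₗ[MvPolynomial (Fin n) 𝕜] B)
    (hμ : ∀ q, ∀ x ∈ 𝒜 q, μ x ∈ ℬ (q + e)) :
    ∃ φ : ∀ i, (G.ι i →₀ MvPolynomial (Fin n) 𝕜) →ₗ[MvPolynomial (Fin n) 𝕜]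
        (F.ι i →₀ MvPolynomial (Fin n) 𝕜),
      (∀ i a, φ i (Finsupp.single a 1) ∈ freePiece 𝕜 n (F.deg i) (G.deg i a + e)) ∧
      (∀ y, F.aug (φ 0 y) = μ (G.aug y)) ∧
      ∀ i y, F.d i (φ (i + 1) y) = φ i (G.d i y) := by
  -- Surjectivity of `F.aug` would not give a lift of the right degree, since the pieces `ℬ` are not
  -- assumed to decompose the module; `hF` supplies it.
  obtain ⟨φ₀, h₀, h₀'⟩ := exists_linearMap_of_basis (𝕜 := 𝕜) (n := n) (deg := G.deg 0)
    (deg' := F.deg 0) (e := e) (P := fun a y => F.aug y = μ (G.aug (Finsupp.single a 1)))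
    fun a => hF _ _ (hμ _ _ (G.aug_homogeneous a))
  have h₀c : F.aug ∘ₗ φ₀ = μ ∘ₗ G.aug := by
    ext a
    simpa using h₀' a
  -- The recursion has to carry the fact that boundaries of `G` are sent to boundaries of `F`: this
  -- is what lets the next component be chosen.
  let Q : ∀ i, ((G.ι i →₀ MvPolynomial (Fin n) 𝕜) →ₗ[MvPolynomial (Fin n) 𝕜]
        (F.ι i →₀ MvPolynomial (Fin n) 𝕜)) → Prop := fun i φ =>
    (∀ a, φ (Finsupp.single a 1) ∈ freePiece 𝕜 n (F.deg i) (G.deg i a + e)) ∧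
      ∀ y, φ (G.d i y) ∈ LinearMap.range (F.d i)
  have hQ₀ : Q 0 φ₀ := by
    refine ⟨h₀, fun y => ?_⟩
    rw [LinearMap.mem_range]
    refine (F.exact_zero _).1 ?_
    have := LinearMap.congr_fun h₀c (G.d 0 y)
    simp only [LinearMap.comp_apply] at this
    rw [this, G.exact_zero.apply_apply_eq_zero, map_zero]
  have step : ∀ i (φ : {φ // Q i φ}), ∃ ψ : {ψ // Q (i + 1) ψ},
      ∀ y, F.d i (ψ.1 y) = φ.1 (G.d i y) := by
    rintro i ⟨φ, hφ, hφ'⟩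
    obtain ⟨ψ, hψ, hψ'⟩ := exists_linearMap_of_basis (𝕜 := 𝕜) (n := n) (deg := G.deg (i + 1))
      (deg' := F.deg (i + 1)) (e := e)
      (P := fun a y => F.d i y = φ (G.d i (Finsupp.single a 1)))
      fun a => exists_mem_freePiece_map_eq (F.d_single_mem i)
        (map_mem_freePiece hφ (G.d_single_mem i a)) (hφ' _)
    have hc : F.d i ∘ₗ ψ = φ ∘ₗ G.d i := by
      ext1 a
      ext1
      simpa using hψ' a
    have hc' : ∀ y, F.d i (ψ y) = φ (G.d i y) := LinearMap.congr_fun hc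
    refine ⟨⟨ψ, hψ, fun y => ?_⟩, hc'⟩
    rw [LinearMap.mem_range]
    refine (F.exact_succ i _).1 ?_
    rw [hc', (G.exact_succ i).apply_apply_eq_zero, map_zero]
  choose next hnext using step
  let φ : ∀ i, {φ // Q i φ} := fun i => Nat.rec ⟨φ₀, hQ₀⟩ next i
  exact ⟨fun i => (φ i).1, fun i => (φ i).2.1, LinearMap.congr_fun h₀c, fun i => hnext i (φ i)⟩

/-! ### Mapping cones: exactness, homogeneity, minimality -/

section coneMap

variable {α β α' β' α'' β'' : Type*} {R : Type*} [CommRing R]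

theorem exists_eq_sumElim (z : α ⊕ β →₀ R) :
    ∃ (x : α →₀ R) (y : β →₀ R), z = Finsupp.sumElim x y :=
  ⟨_, _, (Finsupp.comapDomain_sumElim_comapDomain z).symm⟩

theorem sumElim_inj {x x' : α →₀ R} {y y' : β →₀ R} :
    Finsupp.sumElim x y = Finsupp.sumElim x' y' ↔ x = x' ∧ y = y' :=
  ⟨fun h => ⟨Finsupp.ext fun a => DFunLike.congr_fun h (Sum.inl a),
    Finsupp.ext fun b => DFunLike.congr_fun h (Sum.inr b)⟩, by rintro ⟨rfl, rfl⟩; rfl⟩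

/-- The last differential of a mapping cone. -/
noncomputable def coneMapZero (f : (α →₀ R) →ₗ[R] (α' →₀ R)) (φ : (β →₀ R) →ₗ[R] (α' →₀ R)) :
    (α ⊕ β →₀ R) →ₗ[R] (α' →₀ R) :=
  f.coprod φ ∘ₗ (Finsupp.sumFinsuppLEquivProdFinsupp R).toLinearMap

/-- The other differentials of a mapping cone. -/
noncomputable def coneMapSucc (f : (α →₀ R) →ₗ[R] (α' →₀ R)) (g : (β →₀ R) →ₗ[R] (β' →₀ R))
    (φ : (β →₀ R) →ₗ[R] (α' →₀ R)) : (α ⊕ β →₀ R) →ₗ[R] (α' ⊕ β' →₀ R) :=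
  (Finsupp.sumFinsuppLEquivProdFinsupp R).symm.toLinearMap ∘ₗ
    ((f.coprod φ).prod (-(g ∘ₗ LinearMap.snd _ _ _))) ∘ₗ
    (Finsupp.sumFinsuppLEquivProdFinsupp R).toLinearMap

theorem coneMapZero_sumElim (f : (α →₀ R) →ₗ[R] (α' →₀ R)) (φ : (β →₀ R) →ₗ[R] (α' →₀ R))
    (x : α →₀ R) (y : β →₀ R) : coneMapZero f φ (Finsupp.sumElim x y) = f x + φ y := by
  change f.coprod φ ((Finsupp.sumFinsuppLEquivProdFinsupp R)
    ((Finsupp.sumFinsuppLEquivProdFinsupp R).symm (x, y))) = _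
  rw [LinearEquiv.apply_symm_apply, LinearMap.coprod_apply]

theorem coneMapSucc_sumElim (f : (α →₀ R) →ₗ[R] (α' →₀ R)) (g : (β →₀ R) →ₗ[R] (β' →₀ R))
    (φ : (β →₀ R) →ₗ[R] (α' →₀ R)) (x : α →₀ R) (y : β →₀ R) :
    coneMapSucc f g φ (Finsupp.sumElim x y) = Finsupp.sumElim (f x + φ y) (-(g y)) := by
  change (Finsupp.sumFinsuppLEquivProdFinsupp R).symm (((f.coprod φ).prod
    (-(g ∘ₗ LinearMap.snd _ _ _))) ((Finsupp.sumFinsuppLEquivProdFinsupp R)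
    ((Finsupp.sumFinsuppLEquivProdFinsupp R).symm (x, y)))) = _
  rw [LinearEquiv.apply_symm_apply]
  rfl

/-- If `a x` comes from `m = b y`, subtracting `φ y` from `x` moves it into the kernel of `a`, which
is the image of `f`. -/
theorem exact_coneMapZero {M N P : Type*} [AddCommGroup M] [Module R M] [AddCommGroup N]
    [Module R N] [AddCommGroup P] [Module R P]
    {f : (α →₀ R) →ₗ[R] (α' →₀ R)} {φ : (β →₀ R) →ₗ[R] (α' →₀ R)}
    {a : (α' →₀ R) →ₗ[R] N} {b : (β →₀ R) →ₗ[R] M} {μ : M →ₗ[R] N} {π : N →ₗ[R] P}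
    (hf : Function.Exact f a) (hb : Function.Surjective b) (hex : Function.Exact μ π)
    (hφ : ∀ y, a (φ y) = μ (b y)) : Function.Exact (coneMapZero f φ) (π ∘ₗ a) := by
  intro x
  constructor
  · intro hx
    obtain ⟨m, hm⟩ := (hex _).1 hx
    obtain ⟨y, rfl⟩ := hb m
    obtain ⟨w, hw⟩ := (hf (x - φ y)).1 (by rw [map_sub, hφ, hm, sub_self])
    refine ⟨Finsupp.sumElim w y, ?_⟩
    rw [coneMapZero_sumElim, hw, sub_add_cancel]
  · rintro ⟨z, rfl⟩
    obtain ⟨w, y, rfl⟩ := exists_eq_sumElim z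
    rw [coneMapZero_sumElim, LinearMap.comp_apply, map_add, hf.apply_apply_eq_zero, hφ, zero_add,
      hex.apply_apply_eq_zero]

/-- This is the only place of the cone where injectivity of `μ` enters: it forces the second
coordinate of a cycle to lie in the kernel of `b`. -/
theorem exact_coneMapSucc_zero {M N : Type*} [AddCommGroup M] [Module R M] [AddCommGroup N]
    [Module R N] {f : (α →₀ R) →ₗ[R] (α' →₀ R)} {f' : (α' →₀ R) →ₗ[R] (α'' →₀ R)}
    {g : (β →₀ R) →ₗ[R] (β' →₀ R)} {φ : (β →₀ R) →ₗ[R] (α' →₀ R)}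
    {φ' : (β' →₀ R) →ₗ[R] (α'' →₀ R)} {a : (α'' →₀ R) →ₗ[R] N} {b : (β' →₀ R) →ₗ[R] M}
    {μ : M →ₗ[R] N} (hμ : Function.Injective μ) (hf : Function.Exact f f')
    (hf' : Function.Exact f' a) (hg : Function.Exact g b) (hφ' : ∀ y, a (φ' y) = μ (b y))
    (hφ : ∀ y, f' (φ y) = φ' (g y)) :
    Function.Exact (coneMapSucc f g φ) (coneMapZero f' φ') := by
  intro x
  obtain ⟨x, y, rfl⟩ := exists_eq_sumElim x
  rw [coneMapZero_sumElim]
  constructor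
  · intro h
    have hy : b y = 0 := by
      apply hμ
      have := hf'.apply_apply_eq_zero x
      rw [eq_neg_of_add_eq_zero_left h, map_neg, neg_eq_zero] at this
      rw [map_zero, ← hφ', this]
    obtain ⟨z, rfl⟩ := (hg y).1 hy
    obtain ⟨w, hw⟩ := (hf (x + φ z)).1 (by rw [map_add, hφ, h])
    -- The sign cancels the one in front of `g` in the cone differential.
    refine ⟨Finsupp.sumElim w (-z), ?_⟩
    rw [coneMapSucc_sumElim, hw, map_neg, map_neg, neg_neg, add_neg_cancel_right]
  · rintro ⟨z, hz⟩
    obtain ⟨w, z, rfl⟩ := exists_eq_sumElim z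
    rw [coneMapSucc_sumElim] at hz
    obtain ⟨rfl, rfl⟩ := sumElim_inj.1 hz
    rw [map_add, hf.apply_apply_eq_zero, hφ, map_neg, zero_add, add_neg_cancel]

theorem exact_coneMapSucc {f : (α →₀ R) →ₗ[R] (α' →₀ R)} {f' : (α' →₀ R) →ₗ[R] (α'' →₀ R)}
    {g : (β →₀ R) →ₗ[R] (β' →₀ R)} {g' : (β' →₀ R) →ₗ[R] (β'' →₀ R)}
    {φ : (β →₀ R) →ₗ[R] (α' →₀ R)} {φ' : (β' →₀ R) →ₗ[R] (α'' →₀ R)}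
    (hf : Function.Exact f f') (hg : Function.Exact g g') (hφ : ∀ y, f' (φ y) = φ' (g y)) :
    Function.Exact (coneMapSucc f g φ) (coneMapSucc f' g' φ') := by
  intro x
  obtain ⟨x, y, rfl⟩ := exists_eq_sumElim x
  rw [coneMapSucc_sumElim, ← Finsupp.sumElim_zero_zero, sumElim_inj]
  constructor
  · rintro ⟨h, h'⟩
    obtain ⟨z, rfl⟩ := (hg y).1 (neg_eq_zero.1 h')
    obtain ⟨w, hw⟩ := (hf (x + φ z)).1 (by rw [map_add, hφ, h])
    refine ⟨Finsupp.sumElim w (-z), ?_⟩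
    rw [coneMapSucc_sumElim, hw, map_neg, map_neg, neg_neg, add_neg_cancel_right]
  · rintro ⟨z, hz⟩
    obtain ⟨w, z, rfl⟩ := exists_eq_sumElim z
    rw [coneMapSucc_sumElim] at hz
    obtain ⟨rfl, rfl⟩ := sumElim_inj.1 hz
    rw [map_neg, map_neg, hg.apply_apply_eq_zero, map_add, hf.apply_apply_eq_zero, hφ, neg_zero,
      neg_zero, zero_add, add_neg_cancel]
    exact ⟨rfl, rfl⟩

end coneMap

section coneMapHomogeneous

variable {α β α' β' : Type*} {p : α → ℕ} {q : β → ℕ} {p' : α' → ℕ} {q' : β' → ℕ} {e : ℕ}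
  {f : (α →₀ MvPolynomial (Fin n) 𝕜) →ₗ[MvPolynomial (Fin n) 𝕜] (α' →₀ MvPolynomial (Fin n) 𝕜)}
  {g : (β →₀ MvPolynomial (Fin n) 𝕜) →ₗ[MvPolynomial (Fin n) 𝕜] (β' →₀ MvPolynomial (Fin n) 𝕜)}
  {φ : (β →₀ MvPolynomial (Fin n) 𝕜) →ₗ[MvPolynomial (Fin n) 𝕜] (α' →₀ MvPolynomial (Fin n) 𝕜)}

theorem sumElim_mem_freePiece {r : ℕ}
    {x : α →₀ MvPolynomial (Fin n) 𝕜} {y : β →₀ MvPolynomial (Fin n) 𝕜}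
    (hx : x ∈ freePiece 𝕜 n p r) (hy : y ∈ freePiece 𝕜 n q r) :
    Finsupp.sumElim x y ∈ freePiece 𝕜 n (Sum.elim p q) r := by
  rintro (b | b) s hs
  · exact hx b s hs
  · exact hy b s hs

theorem mem_freePiece_add {r : ℕ} {x : α →₀ MvPolynomial (Fin n) 𝕜}
    (hx : x ∈ freePiece 𝕜 n p r) : x ∈ freePiece 𝕜 n (fun a => p a + e) (r + e) := by
  intro b s hs
  rw [← hx b s hs, add_assoc]

theorem coneMapZero_single_mem (hf : ∀ a, f (Finsupp.single a 1) ∈ freePiece 𝕜 n p' (p a))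
    (hφ : ∀ a, φ (Finsupp.single a 1) ∈ freePiece 𝕜 n p' (q a + e)) (a : α ⊕ β) :
    coneMapZero f φ (Finsupp.single a 1) ∈
      freePiece 𝕜 n p' (Sum.elim p (fun b => q b + e) a) := by
  rcases a with a | a
  · rw [← Finsupp.sumElim_single_zero, coneMapZero_sumElim, map_zero, add_zero]
    exact hf a
  · rw [← Finsupp.sumElim_zero_single, coneMapZero_sumElim, map_zero, zero_add]
    exact hφ a

theorem coneMapSucc_single_mem (hf : ∀ a, f (Finsupp.single a 1) ∈ freePiece 𝕜 n p' (p a))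
    (hg : ∀ a, g (Finsupp.single a 1) ∈ freePiece 𝕜 n q' (q a))
    (hφ : ∀ a, φ (Finsupp.single a 1) ∈ freePiece 𝕜 n p' (q a + e)) (a : α ⊕ β) :
    coneMapSucc f g φ (Finsupp.single a 1) ∈
      freePiece 𝕜 n (Sum.elim p' fun b => q' b + e) (Sum.elim p (fun b => q b + e) a) := by
  rcases a with a | a
  · rw [← Finsupp.sumElim_single_zero, coneMapSucc_sumElim, map_zero, map_zero, add_zero, neg_zero]
    exact sumElim_mem_freePiece (hf a) (zero_mem _)
  · rw [← Finsupp.sumElim_zero_single, coneMapSucc_sumElim, map_zero, zero_add]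
    exact sumElim_mem_freePiece (hφ a) (neg_mem (mem_freePiece_add (hg a)))

end coneMapHomogeneous

section coneMapMinimal

variable {α β α' β' : Type*} {R : Type*} [CommRing R] {I : Ideal R}
  {f : (α →₀ R) →ₗ[R] (α' →₀ R)} {g : (β →₀ R) →ₗ[R] (β' →₀ R)} {φ : (β →₀ R) →ₗ[R] (α' →₀ R)}

theorem mem_smul_top_iff {x : α →₀ R} :
    x ∈ I • (⊤ : Submodule R (α →₀ R)) ↔ ∀ b, x b ∈ I := by
  constructor
  · intro h b
    refine Submodule.smul_induction_on (p := fun x => x b ∈ I) h (fun r hr m _ => ?_)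
      fun x y hx hy => add_mem hx hy
    exact Ideal.mul_mem_right _ _ hr
  · intro hx
    rw [← Finsupp.sum_single x]
    refine Submodule.sum_mem _ fun b _ => ?_
    rw [← mul_one (x b), ← smul_eq_mul, ← Finsupp.smul_single]
    exact Submodule.smul_mem_smul (hx b) trivial

theorem range_coneMapZero_le (hf : LinearMap.range f ≤ I • ⊤) (hφ : LinearMap.range φ ≤ I • ⊤) :
    LinearMap.range (coneMapZero f φ) ≤ I • ⊤ := by
  rintro _ ⟨z, rfl⟩
  obtain ⟨x, y, rfl⟩ := exists_eq_sumElim z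
  rw [coneMapZero_sumElim]
  exact add_mem (hf ⟨x, rfl⟩) (hφ ⟨y, rfl⟩)

theorem range_coneMapSucc_le (hf : LinearMap.range f ≤ I • ⊤) (hg : LinearMap.range g ≤ I • ⊤)
    (hφ : LinearMap.range φ ≤ I • ⊤) : LinearMap.range (coneMapSucc f g φ) ≤ I • ⊤ := by
  rintro _ ⟨z, rfl⟩
  obtain ⟨x, y, rfl⟩ := exists_eq_sumElim z
  rw [coneMapSucc_sumElim, mem_smul_top_iff]
  rintro (b | b)
  · exact mem_smul_top_iff.1 (add_mem (hf ⟨x, rfl⟩) (hφ ⟨y, rfl⟩)) b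
  · exact mem_smul_top_iff.1 (neg_mem (hg ⟨y, rfl⟩)) b

end coneMapMinimal

/-- The index types of the bases of a mapping cone. -/
def coneIndex (I J : ℕ → Type) : ℕ → Type
  | 0 => I 0
  | i + 1 => I (i + 1) ⊕ J i

/-- The degrees of the basis elements of a mapping cone. -/
def coneDeg {I J : ℕ → Type} (f : ∀ i, I i → ℕ) (g : ∀ i, J i → ℕ) (e : ℕ) :
    ∀ i, coneIndex I J i → ℕ
  | 0 => f 0
  | i + 1 => Sum.elim (f (i + 1)) fun b => g i b + e

/-- The differential of a mapping cone. -/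
noncomputable def coneMap {I J : ℕ → Type} {R : Type*} [CommRing R]
    (f : ∀ i, (I (i + 1) →₀ R) →ₗ[R] (I i →₀ R)) (g : ∀ i, (J (i + 1) →₀ R) →ₗ[R] (J i →₀ R))
    (φ : ∀ i, (J i →₀ R) →ₗ[R] (I i →₀ R)) :
    ∀ i, (coneIndex I J (i + 1) →₀ R) →ₗ[R] (coneIndex I J i →₀ R)
  | 0 => coneMapZero (f 0) (φ 0)
  | i + 1 => coneMapSucc (f (i + 1)) (g i) (φ (i + 1))

/-- The mapping cone of a chain map over an injective homogeneous map of degree `e` is a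
resolution of its cokernel. -/
noncomputable def cone (G : GradedFreeResolution (n := n) 𝒜) (F : GradedFreeResolution (n := n) ℬ)
    (e : ℕ) (μ : A →ₗ[MvPolynomial (Fin n) 𝕜] B) (π : B →ₗ[MvPolynomial (Fin n) 𝕜] C)
    (hμ : Function.Injective μ) (hex : Function.Exact μ π) (hπ : Function.Surjective π)
    (hπ' : ∀ q, ∀ x ∈ ℬ q, π x ∈ 𝒞 q)
    (φ : ∀ i, (G.ι i →₀ MvPolynomial (Fin n) 𝕜) →ₗ[MvPolynomial (Fin n) 𝕜]
        (F.ι i →₀ MvPolynomial (Fin n) 𝕜))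
    (hφ : ∀ i a, φ i (Finsupp.single a 1) ∈ freePiece 𝕜 n (F.deg i) (G.deg i a + e))
    (hφ₀ : ∀ y, F.aug (φ 0 y) = μ (G.aug y))
    (hφd : ∀ i y, F.d i (φ (i + 1) y) = φ i (G.d i y)) :
    GradedFreeResolution (n := n) 𝒞 where
  ι := coneIndex F.ι G.ι
  finite_ι i := by
    have := F.finite_ι
    have := G.finite_ι
    cases i with
    | zero => exact F.finite_ι 0
    | succ i => exact inferInstanceAs (Finite (F.ι (i + 1) ⊕ G.ι i))
  deg := coneDeg F.deg G.deg e
  aug := π ∘ₗ F.aug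
  d := coneMap F.d G.d φ
  aug_homogeneous a := hπ' _ _ (F.aug_homogeneous a)
  d_homogeneous i a b s hs := by
    cases i with
    | zero =>
      exact coneMapZero_single_mem (F.d_single_mem 0) (hφ 0) a b s (mem_support_iff.1 hs)
    | succ i =>
      exact coneMapSucc_single_mem (F.d_single_mem (i + 1)) (G.d_single_mem i) (hφ (i + 1)) a b s
        (mem_support_iff.1 hs)
  aug_surjective := hπ.comp F.aug_surjective
  exact_zero := exact_coneMapZero F.exact_zero G.aug_surjective hex hφ₀
  exact_succ i := by
    cases i with
    | zero => exact exact_coneMapSucc_zero hμ (F.exact_succ 0) F.exact_zero G.exact_zero hφ₀ (hφd 0)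
    | succ i => exact exact_coneMapSucc (F.exact_succ (i + 1)) (G.exact_succ i) (hφd (i + 1))

end GradedFreeResolution

/-! ### Minimality, length and degree bounds of mapping cones -/

namespace GradedFreeResolution

variable {𝕜 : Type*} [Field 𝕜] {n : ℕ}
  {A : Type*} [AddCommGroup A] [Module 𝕜 A] [Module (MvPolynomial (Fin n) 𝕜) A]
  {B : Type*} [AddCommGroup B] [Module 𝕜 B] [Module (MvPolynomial (Fin n) 𝕜) B]
  {C : Type*} [AddCommGroup C] [Module 𝕜 C] [Module (MvPolynomial (Fin n) 𝕜) C]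
  {𝒜 : ℕ → Submodule 𝕜 A} {ℬ : ℕ → Submodule 𝕜 B} {𝒞 : ℕ → Submodule 𝕜 C}

/-- All matrix entries have positive degree, hence no constant term. -/
theorem range_le_of_degree_lt {κ κ' : Type*} {deg : κ → ℕ} {deg' : κ' → ℕ} {e : ℕ}
    {φ : (κ →₀ MvPolynomial (Fin n) 𝕜) →ₗ[MvPolynomial (Fin n) 𝕜]
      (κ' →₀ MvPolynomial (Fin n) 𝕜)}
    (hφ : ∀ a, φ (Finsupp.single a 1) ∈ freePiece 𝕜 n deg' (deg a + e))
    (hlt : ∀ a b, deg' b < deg a + e) :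
    LinearMap.range φ ≤ Ideal.span (Set.range (X : Fin n → MvPolynomial (Fin n) 𝕜)) • ⊤ := by
  rintro _ ⟨x, rfl⟩
  rw [← Finsupp.sum_single x, Finsupp.sum, map_sum]
  refine Submodule.sum_mem _ fun a _ => ?_
  rw [← mul_one (x a), ← smul_eq_mul, ← Finsupp.smul_single, map_smul]
  refine Submodule.smul_mem _ _ (mem_smul_top_iff.2 fun b => mem_span_range_X fun s hs => ?_)
  have := hφ a b s hs
  have := hlt a b
  omega

/-- A minimal resolution of length `ℓ`, with `i ≤ j ≤ i + r` for all summands `S(-j)` of `Fᵢ` and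
with equality `j = i + r` for some of them. -/
structure IsMinimalOfType (F : GradedFreeResolution (n := n) ℬ) (ℓ r : ℕ) : Prop where
  lifts : F.LiftsHomogeneous
  minimal : F.IsMinimal
  length : IsGreatest {i | Nonempty (F.ι i)} ℓ
  le_deg : ∀ i a, i ≤ F.deg i a
  deg_le : ∀ i a, F.deg i a ≤ i + r
  exists_deg_eq : ∃ i a, F.deg i a = i + r

/-- `G` is linear, so its shifted generators in step `i` have degree `i + e + 1`, which exceeds the
bound `i + r` for `F` because `r ≤ e`. Hence the comparison map has entries in the maximal ideal and
the cone is minimal. In step `i + 1` of the cone these generators lie exactly on the line `j - i =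
e`. -/
theorem IsMinimalOfType.exists_cokernel {G : GradedFreeResolution (n := n) 𝒜}
    {F : GradedFreeResolution (n := n) ℬ} {ℓ ℓ' r e : ℕ}
    (hG : G.IsMinimalOfType ℓ' 0) (hF : F.IsMinimalOfType ℓ r) (hr : r ≤ e)
    {μ : A →ₗ[MvPolynomial (Fin n) 𝕜] B} {π : B →ₗ[MvPolynomial (Fin n) 𝕜] C}
    (hμ : Function.Injective μ) (hμ' : ∀ q, ∀ x ∈ 𝒜 q, μ x ∈ ℬ (q + (e + 1)))
    (hex : Function.Exact μ π) (hπ : Function.Surjective π)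
    (hπ' : ∀ q, ∀ x ∈ ℬ q, π x ∈ 𝒞 q) (hπ'' : ∀ q, ∀ x ∈ 𝒞 q, ∃ y ∈ ℬ q, π y = x) :
    ∃ H : GradedFreeResolution (n := n) 𝒞, H.IsMinimalOfType (max ℓ (ℓ' + 1)) e := by
  obtain ⟨φ, hφ, hφ₀, hφd⟩ := G.exists_chainMap F hF.lifts (e + 1) μ hμ'
  have hφm : ∀ i, LinearMap.range (φ i) ≤
      Ideal.span (Set.range (X : Fin n → MvPolynomial (Fin n) 𝕜)) • ⊤ := fun i =>
    range_le_of_degree_lt (hφ i) fun a b => by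
      have := hG.le_deg i a
      have := hF.deg_le i b
      omega
  refine ⟨cone G F (e + 1) μ π hμ hex hπ hπ' φ hφ hφ₀ hφd, ?_, ?_, ⟨?_, ?_⟩, ?_, ?_, ?_⟩
  · intro q x hx
    obtain ⟨y, hy, rfl⟩ := hπ'' q x hx
    obtain ⟨z, hz, rfl⟩ := hF.lifts q y hy
    exact ⟨z, hz, rfl⟩
  · rintro (_ | i)
    · exact range_coneMapZero_le (hF.minimal 0) (hφm 0)
    · exact range_coneMapSucc_le (hF.minimal (i + 1)) (hG.minimal i) (hφm (i + 1))
  · rcases max_choice ℓ (ℓ' + 1) with h | h <;> rw [h]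
    · obtain ⟨a⟩ := hF.length.1
      cases ℓ with
      | zero => exact ⟨a⟩
      | succ ℓ => exact ⟨Sum.inl a⟩
    · obtain ⟨a⟩ := hG.length.1
      exact ⟨Sum.inr a⟩
  · rintro (_ | i) ⟨a⟩
    · exact Nat.zero_le _
    · rcases a with a | a
      · exact le_max_of_le_left (hF.length.2 ⟨a⟩)
      · exact le_max_of_le_right (Nat.succ_le_succ (hG.length.2 ⟨a⟩))
  · rintro (_ | i) a
    · exact Nat.zero_le _
    · rcases a with a | a
      · exact hF.le_deg (i + 1) a
      · have := hG.le_deg i a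
        change i + 1 ≤ G.deg i a + (e + 1)
        omega
  · rintro (_ | i) a
    · exact (hF.deg_le 0 a).trans (by omega)
    · rcases a with a | a
      · exact (hF.deg_le (i + 1) a).trans (by omega)
      · have := hG.deg_le i a
        change G.deg i a + (e + 1) ≤ i + 1 + e
        omega
  · obtain ⟨i, a, ha⟩ := hG.exists_deg_eq
    refine ⟨i + 1, Sum.inr a, ?_⟩
    change G.deg i a + (e + 1) = i + 1 + e
    omega

theorem IsMinimalOfType.hasProjDim {F : GradedFreeResolution (n := n) ℬ} {ℓ r : ℕ}
    (hF : F.IsMinimalOfType ℓ r) : HasProjDim n ℬ ℓ :=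
  ⟨F, hF.minimal, hF.length⟩

theorem IsMinimalOfType.hasRegularity {F : GradedFreeResolution (n := n) ℬ} {ℓ r : ℕ}
    (hF : F.IsMinimalOfType ℓ r) : HasRegularity n ℬ r := by
  refine ⟨F, hF.minimal, ?_, ?_⟩
  · obtain ⟨i, a, ha⟩ := hF.exists_deg_eq
    refine ⟨i, i + r, ?_, by push_cast; ring⟩
    -- Finiteness matters: `Nat.card` of an infinite type would be zero.
    have := F.finite_ι i
    have : Nonempty {a : F.ι i // F.deg i a = i + r} := ⟨⟨a, ha⟩⟩
    exact Nat.card_pos.ne'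
  · rintro m ⟨i, j, hb, rfl⟩
    obtain ⟨⟨a, ha⟩⟩ := (Nat.card_ne_zero.1 hb).1
    have := hF.deg_le i a
    omega

end GradedFreeResolution

/-! ### The exact sequence of a colon ideal -/

section Multiplication

variable {𝕜 : Type*} [Field 𝕜] {n : ℕ}

/-- Multiplication by `u` as a map `S ⧸ C → S ⧸ I`. -/
noncomputable def quotientMul {C I : Ideal (MvPolynomial (Fin n) 𝕜)} (u : MvPolynomial (Fin n) 𝕜)
    (h : ∀ f, f ∈ C ↔ f * u ∈ I) :
    (MvPolynomial (Fin n) 𝕜 ⧸ C) →ₗ[MvPolynomial (Fin n) 𝕜] (MvPolynomial (Fin n) 𝕜 ⧸ I) :=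
  Submodule.mapQ C I (LinearMap.mulRight _ u) fun f hf => (h f).1 hf

/-- The projection `S ⧸ I → S ⧸ J`. -/
noncomputable def quotientProj {I J : Ideal (MvPolynomial (Fin n) 𝕜)} (h : I ≤ J) :
    (MvPolynomial (Fin n) 𝕜 ⧸ I) →ₗ[MvPolynomial (Fin n) 𝕜] (MvPolynomial (Fin n) 𝕜 ⧸ J) :=
  Submodule.mapQ I J LinearMap.id h

variable {C I J : Ideal (MvPolynomial (Fin n) 𝕜)} {u : MvPolynomial (Fin n) 𝕜}

theorem quotientMul_mk (h : ∀ f, f ∈ C ↔ f * u ∈ I) (f : MvPolynomial (Fin n) 𝕜) :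
    quotientMul u h (Ideal.Quotient.mk C f) = Ideal.Quotient.mk I (f * u) := rfl

theorem quotientProj_mk (h : I ≤ J) (f : MvPolynomial (Fin n) 𝕜) :
    quotientProj h (Ideal.Quotient.mk I f) = Ideal.Quotient.mk J f := rfl

theorem quotientMul_injective (h : ∀ f, f ∈ C ↔ f * u ∈ I) :
    Function.Injective (quotientMul u h) := by
  rw [injective_iff_map_eq_zero]
  intro x hx
  obtain ⟨f, rfl⟩ := Ideal.Quotient.mk_surjective x
  rw [quotientMul_mk, Ideal.Quotient.eq_zero_iff_mem] at hx
  exact Ideal.Quotient.eq_zero_iff_mem.2 ((h f).2 hx)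

theorem quotientProj_surjective (h : I ≤ J) : Function.Surjective (quotientProj h) := by
  intro x
  obtain ⟨f, rfl⟩ := Ideal.Quotient.mk_surjective x
  exact ⟨_, quotientProj_mk h f⟩

/-- The hypothesis `h` says `C = I : u`, and the kernel of `S/I → S/(I + (u))` is generated by the
class of `u`. -/
theorem exact_quotientMul_quotientProj (h : ∀ f, f ∈ C ↔ f * u ∈ I)
    (hJ : J = I ⊔ Ideal.span {u}) (hIJ : I ≤ J) :
    Function.Exact (quotientMul u h) (quotientProj hIJ) := by
  subst hJ
  intro x
  obtain ⟨f, rfl⟩ := Ideal.Quotient.mk_surjective x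
  rw [quotientProj_mk, Ideal.Quotient.eq_zero_iff_mem]
  constructor
  · intro hf
    obtain ⟨g, hg, w, hw, rfl⟩ := Submodule.mem_sup.1 hf
    obtain ⟨v, rfl⟩ := Ideal.mem_span_singleton'.1 hw
    refine ⟨Ideal.Quotient.mk C v, ?_⟩
    rw [quotientMul_mk, map_add, Ideal.Quotient.eq_zero_iff_mem.2 hg, zero_add]
  · rintro ⟨y, hy⟩
    obtain ⟨v, rfl⟩ := Ideal.Quotient.mk_surjective y
    rw [quotientMul_mk, Ideal.Quotient.eq] at hy
    have h1 : v * u ∈ I ⊔ Ideal.span {u} :=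
      Ideal.mem_sup_right (Ideal.mul_mem_left _ _ (Ideal.mem_span_singleton_self u))
    have := sub_mem h1 (Ideal.mem_sup_left (T := Ideal.span {u}) hy)
    rwa [sub_sub_cancel] at this

theorem mem_quotientPiece {q : ℕ} {x : MvPolynomial (Fin n) 𝕜 ⧸ I} :
    x ∈ quotientPiece I q ↔ ∃ f, f.IsHomogeneous q ∧ Ideal.Quotient.mk I f = x := Iff.rfl

theorem quotientMul_mem (h : ∀ f, f ∈ C ↔ f * u ∈ I) {e : ℕ} (hu : u.IsHomogeneous e) {q : ℕ}
    {x : MvPolynomial (Fin n) 𝕜 ⧸ C} (hx : x ∈ quotientPiece C q) :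
    quotientMul u h x ∈ quotientPiece I (q + e) := by
  obtain ⟨f, hf, rfl⟩ := mem_quotientPiece.1 hx
  exact mem_quotientPiece.2 ⟨f * u, hf.mul hu, rfl⟩

theorem quotientProj_mem (h : I ≤ J) {q : ℕ}
    {x : MvPolynomial (Fin n) 𝕜 ⧸ I} (hx : x ∈ quotientPiece I q) :
    quotientProj h x ∈ quotientPiece J q := by
  obtain ⟨f, hf, rfl⟩ := mem_quotientPiece.1 hx
  exact mem_quotientPiece.2 ⟨f, hf, rfl⟩

theorem exists_quotientProj_eq (h : I ≤ J) {q : ℕ}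
    {x : MvPolynomial (Fin n) 𝕜 ⧸ J} (hx : x ∈ quotientPiece J q) :
    ∃ y ∈ quotientPiece I q, quotientProj h y = x := by
  obtain ⟨f, hf, rfl⟩ := mem_quotientPiece.1 hx
  exact ⟨Ideal.Quotient.mk I f, mem_quotientPiece.2 ⟨f, hf, rfl⟩, rfl⟩

/-- `S ⧸ I` has a minimal graded free resolution of length `ℓ`, with `i ≤ j ≤ i + r` for all
summands `S(-j)` of the `i`-th module, and with `j = i + r` for some of them. -/
def HasResolutionType (I : Ideal (MvPolynomial (Fin n) 𝕜)) (ℓ r : ℕ) : Prop :=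
  ∃ F : GradedFreeResolution (n := n) (quotientPiece I), F.IsMinimalOfType ℓ r

theorem HasResolutionType.sup_span_singleton {ℓ ℓ' r e : ℕ} (hI : HasResolutionType I ℓ r)
    (hC : HasResolutionType C ℓ' 0) (hu : u.IsHomogeneous (e + 1)) (hr : r ≤ e)
    (h : ∀ f, f ∈ C ↔ f * u ∈ I) :
    HasResolutionType (I ⊔ Ideal.span {u}) (max ℓ (ℓ' + 1)) e := by
  obtain ⟨F, hF⟩ := hI
  obtain ⟨G, hG⟩ := hC
  exact hG.exists_cokernel hF hr (quotientMul_injective h) (fun q x => quotientMul_mem h hu)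
    (exact_quotientMul_quotientProj h rfl le_sup_left) (quotientProj_surjective le_sup_left)
    (fun q x => quotientProj_mem le_sup_left) (fun q x => exists_quotientProj_eq le_sup_left)

/-- The resolution of `S` by itself. -/
noncomputable def trivialResolution (𝕜 : Type*) [Field 𝕜] (n : ℕ) :
    GradedFreeResolution (n := n) (quotientPiece (⊥ : Ideal (MvPolynomial (Fin n) 𝕜))) where
  ι i := {_x : Unit // i = 0}
  finite_ι i := inferInstance
  deg _ _ := 0
  aug := (Submodule.mkQ (⊥ : Ideal (MvPolynomial (Fin n) 𝕜))) ∘ₗ Finsupp.lapply ⟨(), rfl⟩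
  d _ := 0
  aug_homogeneous a :=
    mem_quotientPiece.2 ⟨1, isHomogeneous_one _ _, by
      obtain ⟨⟨⟩, _⟩ := a
      simp⟩
  d_homogeneous i a := absurd a.2 (by omega)
  aug_surjective := by
    refine (Submodule.mkQ_surjective _).comp fun f => ⟨Finsupp.single ⟨(), rfl⟩ f, ?_⟩
    simp
  exact_zero x := by
    constructor
    · intro hx
      have hx' : x ⟨(), rfl⟩ ∈ (⊥ : Ideal (MvPolynomial (Fin n) 𝕜)) :=
        (Submodule.Quotient.mk_eq_zero _).1 hx
      refine ⟨0, ?_⟩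
      rw [map_zero]
      ext1 ⟨⟨⟩, _⟩
      exact ((Submodule.mem_bot _).1 hx').symm
    · rintro ⟨y, rfl⟩
      simp
  exact_succ i x := by
    constructor
    · intro _
      refine ⟨0, Finsupp.ext fun a => absurd a.2 (by omega)⟩
    · intro _
      rfl

theorem hasResolutionType_bot :
    HasResolutionType (⊥ : Ideal (MvPolynomial (Fin n) 𝕜)) 0 0 := by
  refine ⟨trivialResolution 𝕜 n, ?_, ?_, ⟨⟨⟨(), rfl⟩⟩, ?_⟩, ?_, ?_, ⟨0, ⟨(), rfl⟩, rfl⟩⟩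
  · intro q x hx
    obtain ⟨f, hf, rfl⟩ := mem_quotientPiece.1 hx
    have key : Finsupp.single (⟨(), rfl⟩ : {_x : Unit // (0 : ℕ) = 0}) f ⟨(), rfl⟩ = f :=
      Finsupp.single_eq_same
    refine ⟨Finsupp.single ⟨(), rfl⟩ f, ?_, congrArg (Ideal.Quotient.mk ⊥) key⟩
    rintro ⟨⟨⟩, _⟩ s hs
    exact (add_zero _).trans (by_contra fun h =>
      hs ((congrArg (coeff s) key).trans (hf.coeff_eq_zero h)))
  · intro i
    rw [show (trivialResolution 𝕜 n).d i = 0 from rfl, LinearMap.range_zero]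
    exact bot_le
  · rintro i ⟨a⟩
    exact a.2.le
  · intro i a
    exact a.2.le
  · intro i a
    exact Nat.zero_le _

end Multiplication

/-! ### Squarefree monomial ideals and colon ideals generated by variables -/

section SquarefreeMonomialIdeal

variable {𝕜 : Type*} [Field 𝕜] {n : ℕ}

/-- The exponent of the squarefree monomial with support `σ`. -/
noncomputable def squarefreeExponent (σ : Finset (Fin n)) : Fin n →₀ ℕ :=
  ∑ x ∈ σ, Finsupp.single x 1

theorem squarefreeExponent_apply (σ : Finset (Fin n)) (x : Fin n) :
    squarefreeExponent σ x = if x ∈ σ then 1 else 0 := by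
  simp [squarefreeExponent, Finsupp.finsetSum_apply, Finsupp.single_apply]

theorem degree_squarefreeExponent (σ : Finset (Fin n)) :
    (squarefreeExponent σ).degree = σ.card := by
  simp [squarefreeExponent, map_sum]

theorem monomial_squarefreeExponent (σ : Finset (Fin n)) :
    monomial (squarefreeExponent σ) (1 : 𝕜) = ∏ x ∈ σ, X x := by
  rw [squarefreeExponent, monomial_sum_one]
  rfl

/-- The ideal generated by the squarefree monomials with supports in `𝓕`. -/
noncomputable def squarefreeIdeal (𝕜 : Type*) [Field 𝕜] (𝓕 : Set (Finset (Fin n))) :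
    Ideal (MvPolynomial (Fin n) 𝕜) :=
  Ideal.span ((fun σ => monomial (squarefreeExponent σ) (1 : 𝕜)) '' 𝓕)

/-- Membership in a monomial ideal is tested monomial by monomial, and a squarefree monomial divides
another one exactly when its support is contained in the other support. -/
theorem mem_squarefreeIdeal {𝓕 : Set (Finset (Fin n))} {f : MvPolynomial (Fin n) 𝕜} :
    f ∈ squarefreeIdeal 𝕜 𝓕 ↔
      ∀ s ∈ f.support, ∃ σ ∈ 𝓕, ∀ x ∈ σ, s x ≠ 0 := by
  have h := mem_ideal_span_monomial_image (R := 𝕜) (x := f) (s := squarefreeExponent '' 𝓕)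
  rw [Set.image_image] at h
  refine h.trans (forall₂_congr fun s _ => ?_)
  rw [Set.exists_mem_image]
  refine exists_congr fun σ => and_congr_right fun _ => ?_
  rw [Finsupp.le_def]
  refine forall_congr' fun x => ?_
  rw [squarefreeExponent_apply]
  split_ifs with hx
  · simp [hx, Nat.one_le_iff_ne_zero]
  · simp [hx]

theorem squarefreeIdeal_insert (τ : Finset (Fin n)) (𝓕 : Set (Finset (Fin n))) :
    squarefreeIdeal 𝕜 (insert τ 𝓕) =
      squarefreeIdeal 𝕜 𝓕 ⊔ Ideal.span {monomial (squarefreeExponent τ) (1 : 𝕜)} := by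
  rw [squarefreeIdeal, Set.image_insert_eq, Ideal.span_insert, sup_comm]
  rfl

theorem squarefreeIdeal_eq_of_subset {𝓕 𝓖 : Set (Finset (Fin n))} (h : 𝓕 ⊆ 𝓖)
    (h' : ∀ σ ∈ 𝓖, ∃ ρ ∈ 𝓕, ρ ⊆ σ) : squarefreeIdeal 𝕜 𝓖 = squarefreeIdeal 𝕜 𝓕 := by
  ext f
  rw [mem_squarefreeIdeal, mem_squarefreeIdeal]
  refine forall₂_congr fun s _ => ⟨?_, ?_⟩
  · rintro ⟨σ, hσ, hs⟩
    obtain ⟨ρ, hρ, hρσ⟩ := h' σ hσ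
    exact ⟨ρ, hρ, fun x hx => hs x (hρσ hx)⟩
  · rintro ⟨σ, hσ, hs⟩
    exact ⟨σ, h hσ, hs⟩

/-- The ideal generated by the variables in `A`. -/
noncomputable def variableIdeal (𝕜 : Type*) [Field 𝕜] (A : Finset (Fin n)) :
    Ideal (MvPolynomial (Fin n) 𝕜) :=
  squarefreeIdeal 𝕜 ((fun x => {x}) '' (A : Set (Fin n)))

theorem mem_variableIdeal {A : Finset (Fin n)} {f : MvPolynomial (Fin n) 𝕜} :
    f ∈ variableIdeal 𝕜 A ↔ ∀ s ∈ f.support, ∃ x ∈ A, s x ≠ 0 := by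
  rw [variableIdeal, mem_squarefreeIdeal]
  simp

theorem variableIdeal_eq_span (A : Finset (Fin n)) :
    variableIdeal 𝕜 A = Ideal.span (X '' (A : Set (Fin n))) := by
  ext f
  rw [mem_variableIdeal, mem_ideal_span_X_image]
  rfl

theorem variableIdeal_insert (A : Finset (Fin n)) (x : Fin n) :
    variableIdeal 𝕜 (insert x A) =
      squarefreeIdeal 𝕜 (insert {x} ((fun x => {x}) '' (A : Set (Fin n)))) := by
  rw [variableIdeal, Finset.coe_insert, Set.image_insert_eq]

/-- `A` is the set of variables generating the colon ideal of the squarefree monomial ideal of `𝓕`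
by the squarefree monomial with support `τ`. -/
structure IsVariableColon (𝓕 : Set (Finset (Fin n))) (τ A : Finset (Fin n)) : Prop where
  exists_subset_insert : ∀ x ∈ A, ∃ σ ∈ 𝓕, σ ⊆ insert x τ
  exists_mem : ∀ σ ∈ 𝓕, ∃ x ∈ σ, x ∉ τ ∧ x ∈ A

variable {𝓕 : Set (Finset (Fin n))} {τ A : Finset (Fin n)}

/-- Each `x ∈ A` multiplies the monomial of `τ` into the ideal. Conversely, if a generator `σ`
divides a monomial times that of `τ`, its variable in `A` outside `τ` must divide the first factor.
-/
theorem IsVariableColon.mem_iff (h : IsVariableColon 𝓕 τ A) (f : MvPolynomial (Fin n) 𝕜) :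
    f ∈ variableIdeal 𝕜 A ↔
      f * monomial (squarefreeExponent τ) 1 ∈ squarefreeIdeal 𝕜 𝓕 := by
  rw [mem_variableIdeal, mem_squarefreeIdeal]
  constructor
  · intro hf s hs
    rw [mem_support_iff, coeff_mul_monomial'] at hs
    split_ifs at hs with hle
    · rw [mul_one] at hs
      obtain ⟨x, hx, hsx⟩ := hf _ (mem_support_iff.2 hs)
      obtain ⟨σ, hσ, hσx⟩ := h.exists_subset_insert x hx
      refine ⟨σ, hσ, fun y hy => ?_⟩
      rcases Finset.mem_insert.1 (hσx hy) with rfl | hy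
      · rw [Finsupp.tsub_apply] at hsx
        omega
      · have := hle y
        rw [squarefreeExponent_apply, if_pos hy] at this
        omega
    · exact absurd rfl hs
  · intro hf s hs
    obtain ⟨σ, hσ, hs'⟩ := hf (s + squarefreeExponent τ) (by
      rw [mem_support_iff, coeff_mul_monomial, mul_one]
      exact mem_support_iff.1 hs)
    obtain ⟨x, hx, hxτ, hxA⟩ := h.exists_mem σ hσ
    refine ⟨x, hxA, ?_⟩
    have := hs' x hx
    rwa [Finsupp.add_apply, squarefreeExponent_apply, if_neg hxτ] at this

theorem isHomogeneous_squarefree (τ : Finset (Fin n)) :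
    (monomial (squarefreeExponent τ) (1 : 𝕜)).IsHomogeneous τ.card :=
  isHomogeneous_monomial _ (degree_squarefreeExponent τ)

theorem IsVariableColon.hasResolutionType_insert (h : IsVariableColon 𝓕 τ A) {ℓ ℓ' r e : ℕ}
    (h𝓕 : HasResolutionType (squarefreeIdeal 𝕜 𝓕) ℓ r)
    (hA : HasResolutionType (variableIdeal 𝕜 A) ℓ' 0) (hτ : τ.card = e + 1) (hr : r ≤ e) :
    HasResolutionType (squarefreeIdeal 𝕜 (insert τ 𝓕)) (max ℓ (ℓ' + 1)) e := by
  rw [squarefreeIdeal_insert]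
  exact h𝓕.sup_span_singleton hA (hτ ▸ isHomogeneous_squarefree τ) hr h.mem_iff

theorem isVariableColon_singleton {x : Fin n} (hx : x ∉ A) :
    IsVariableColon ((fun x => {x}) '' (A : Set (Fin n))) {x} A where
  exists_subset_insert y hy := ⟨{y}, ⟨y, hy, rfl⟩, by simp⟩
  exists_mem := by
    rintro _ ⟨y, hy, rfl⟩
    refine ⟨y, by simp, ?_, hy⟩
    rw [Finset.mem_singleton]
    rintro rfl
    exact hx hy

theorem squarefreeIdeal_empty : squarefreeIdeal 𝕜 (∅ : Set (Finset (Fin n))) = ⊥ := by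
  rw [squarefreeIdeal, Set.image_empty, Ideal.span_empty]

/-- The Koszul resolution. -/
theorem hasResolutionType_variableIdeal (A : Finset (Fin n)) :
    HasResolutionType (variableIdeal 𝕜 A) A.card 0 := by
  induction A using Finset.induction_on with
  | empty =>
    rw [variableIdeal, Finset.coe_empty, Set.image_empty, squarefreeIdeal_empty]
    exact hasResolutionType_bot
  | insert x A hx ih =>
    -- The variables form a regular sequence, so the colon ideal is `variableIdeal 𝕜 A` itself and
    -- `ih` serves for both terms.
    have := (isVariableColon_singleton hx).hasResolutionType_insert ih ih (e := 0) rfl le_rfl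
    rw [variableIdeal_insert, Finset.card_insert_of_notMem hx]
    rwa [max_eq_right (Nat.le_succ _)] at this

/-! ### Hilbert series along the exact sequences -/

section Hilbert

theorem homogeneousComponent_mem_squarefreeIdeal {f : MvPolynomial (Fin n) 𝕜}
    (hf : f ∈ squarefreeIdeal 𝕜 𝓕) (q : ℕ) :
    homogeneousComponent q f ∈ squarefreeIdeal 𝕜 𝓕 := by
  rw [mem_squarefreeIdeal] at hf ⊢
  intro s hs
  refine hf s (mem_support_iff.2 fun h => ?_)
  rw [mem_support_iff, coeff_homogeneousComponent, h, ite_self] at hs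
  exact hs rfl

theorem homogeneousComponent_mul_monomial (q : ℕ) (f : MvPolynomial (Fin n) 𝕜)
    (m : Fin n →₀ ℕ) :
    homogeneousComponent q (f * monomial m 1) =
      if m.degree ≤ q then homogeneousComponent (q - m.degree) f * monomial m 1 else 0 := by
  ext s
  rw [coeff_homogeneousComponent, coeff_mul_monomial']
  by_cases hm : m ≤ s
  · have hd : (s - m).degree + m.degree = s.degree := by
      rw [← map_add, tsub_add_cancel_of_le hm]
    rw [if_pos hm]
    by_cases hq : m.degree ≤ q
    · rw [if_pos hq, coeff_mul_monomial', if_pos hm, coeff_homogeneousComponent, mul_one, mul_one]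
      congr 1
      exact propext ⟨fun _ => by omega, fun _ => by omega⟩
    · rw [if_neg hq, if_neg (by omega), coeff_zero]
  · rw [if_neg hm, ite_self]
    split_ifs
    · rw [coeff_mul_monomial', if_neg hm]
    · rw [coeff_zero]

instance (I : Ideal (MvPolynomial (Fin n) 𝕜)) (q : ℕ) : Module.Finite 𝕜 (quotientPiece I q) := by
  rw [Module.Finite.iff_fg]
  exact (homogeneousSubmodule_fg (σ := Fin n) (R := 𝕜) q).map _

/-- This is rank-nullity in degree `q`: the kernel of the projection is the image of multiplication
by the monomial, and it vanishes when `q < τ.card`. -/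
theorem IsVariableColon.finrank_quotientPiece (h : IsVariableColon 𝓕 τ A) (q : ℕ) :
    Module.finrank 𝕜 (quotientPiece (squarefreeIdeal 𝕜 𝓕) q) =
      Module.finrank 𝕜 (quotientPiece (squarefreeIdeal 𝕜 (insert τ 𝓕)) q) +
        if τ.card ≤ q then Module.finrank 𝕜 (quotientPiece (variableIdeal 𝕜 A) (q - τ.card))
        else 0 := by
  have hle : squarefreeIdeal 𝕜 𝓕 ≤ squarefreeIdeal 𝕜 (insert τ 𝓕) := by
    rw [squarefreeIdeal_insert]
    exact le_sup_left
  have hu := isHomogeneous_squarefree (𝕜 := 𝕜) τ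
  let p : quotientPiece (squarefreeIdeal 𝕜 𝓕) q →ₗ[𝕜]
      quotientPiece (squarefreeIdeal 𝕜 (insert τ 𝓕)) q :=
    ((quotientProj hle).restrictScalars 𝕜).restrict fun x hx => quotientProj_mem hle hx
  have hp : LinearMap.range p = ⊤ := by
    rw [LinearMap.range_eq_top]
    rintro ⟨x, hx⟩
    obtain ⟨y, hy, hyx⟩ := exists_quotientProj_eq hle hx
    exact ⟨⟨y, hy⟩, Subtype.ext hyx⟩
  -- The cofactor `v` need not be homogeneous; passing to the component of degree `q` of the product
  -- repairs this, as the ideal is homogeneous.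
  have hker : ∀ f : MvPolynomial (Fin n) 𝕜, f.IsHomogeneous q →
      f ∈ squarefreeIdeal 𝕜 (insert τ 𝓕) → ∃ v, f - homogeneousComponent q
        (v * monomial (squarefreeExponent τ) 1) ∈ squarefreeIdeal 𝕜 𝓕 := by
    intro f hf hmem
    rw [squarefreeIdeal_insert] at hmem
    obtain ⟨g, hg, w, hw, hgw⟩ := Submodule.mem_sup.1 hmem
    obtain ⟨v, rfl⟩ := Ideal.mem_span_singleton'.1 hw
    refine ⟨v, ?_⟩
    rw [← homogeneousComponent_eq_self hf, ← map_sub, ← hgw, add_sub_cancel_right]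
    exact homogeneousComponent_mem_squarefreeIdeal hg q
  rw [← LinearMap.finrank_range_add_finrank_ker p, hp, finrank_top]
  congr 1
  split_ifs with hq
  · let m : quotientPiece (variableIdeal 𝕜 A) (q - τ.card) →ₗ[𝕜]
        quotientPiece (squarefreeIdeal 𝕜 𝓕) q :=
      ((quotientMul _ h.mem_iff).restrictScalars 𝕜).restrict fun x hx => by
        have := quotientMul_mem h.mem_iff hu hx
        rwa [Nat.sub_add_cancel hq] at this
    have hm : Function.Injective m := fun x y hxy =>
      Subtype.ext (quotientMul_injective h.mem_iff (Subtype.ext_iff.1 hxy))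
    rw [← LinearMap.finrank_range_of_inj hm]
    suffices hpm : LinearMap.ker p = LinearMap.range m by rw [hpm]
    ext ⟨x, hx⟩
    rw [LinearMap.mem_ker, LinearMap.mem_range]
    constructor
    · intro hpx
      obtain ⟨f, hf, rfl⟩ := mem_quotientPiece.1 hx
      obtain ⟨v, hv⟩ := hker f hf (Ideal.Quotient.eq_zero_iff_mem.1 (Subtype.ext_iff.1 hpx))
      rw [homogeneousComponent_mul_monomial, degree_squarefreeExponent, if_pos hq] at hv
      refine ⟨⟨Ideal.Quotient.mk _ (homogeneousComponent (q - τ.card) v), mem_quotientPiece.2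
        ⟨_, homogeneousComponent_isHomogeneous _ _, rfl⟩⟩, Subtype.ext ?_⟩
      exact (Ideal.Quotient.eq.2 hv).symm
    · rintro ⟨y, hy⟩
      rw [← hy]
      exact Subtype.ext ((exact_quotientMul_quotientProj h.mem_iff
        (squarefreeIdeal_insert τ 𝓕) hle).apply_apply_eq_zero y.1)
  · rw [LinearMap.ker_eq_bot.2, finrank_bot]
    rw [injective_iff_map_eq_zero]
    rintro ⟨x, hx⟩ hpx
    obtain ⟨f, hf, rfl⟩ := mem_quotientPiece.1 hx
    obtain ⟨v, hv⟩ := hker f hf (Ideal.Quotient.eq_zero_iff_mem.1 (Subtype.ext_iff.1 hpx))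
    rw [homogeneousComponent_mul_monomial, degree_squarefreeExponent, if_neg hq, sub_zero] at hv
    exact Subtype.ext (Ideal.Quotient.eq_zero_iff_mem.2 hv)

theorem IsVariableColon.gradedHilbertSeries_eq (h : IsVariableColon 𝓕 τ A) :
    gradedHilbertSeries (quotientPiece (squarefreeIdeal 𝕜 𝓕)) =
      gradedHilbertSeries (quotientPiece (squarefreeIdeal 𝕜 (insert τ 𝓕))) +
        PowerSeries.X ^ τ.card * gradedHilbertSeries (quotientPiece (variableIdeal 𝕜 A)) := by
  ext q
  rw [map_add, PowerSeries.coeff_X_pow_mul']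
  simp only [gradedHilbertSeries, PowerSeries.coeff_mk, h.finrank_quotientPiece (𝕜 := 𝕜) q]
  split_ifs <;> push_cast <;> rfl

theorem gradedHilbertSeries_variableIdeal_univ :
    gradedHilbertSeries (quotientPiece (variableIdeal 𝕜 (Finset.univ : Finset (Fin n)))) = 1 := by
  ext q
  rw [gradedHilbertSeries, PowerSeries.coeff_mk, PowerSeries.coeff_one]
  split_ifs with hq
  · subst hq
    have h1 : (1 : MvPolynomial (Fin n) 𝕜 ⧸ variableIdeal 𝕜 Finset.univ) ≠ 0 := by
      intro h
      have h' : (1 : MvPolynomial (Fin n) 𝕜) ∈ variableIdeal 𝕜 Finset.univ :=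
        Ideal.Quotient.eq_zero_iff_mem.1 ((map_one _).trans h)
      obtain ⟨x, _, hx⟩ := mem_variableIdeal.1 h' 0 (by simp)
      exact hx rfl
    have : quotientPiece (variableIdeal 𝕜 (Finset.univ : Finset (Fin n))) 0 = 𝕜 ∙ 1 := by
      ext x
      rw [mem_quotientPiece, Submodule.mem_span_singleton]
      constructor
      · rintro ⟨f, hf, rfl⟩
        rw [← totalDegree_zero_iff_isHomogeneous, totalDegree_eq_zero_iff_eq_C] at hf
        refine ⟨coeff 0 f, ?_⟩
        rw [hf, coeff_C, if_pos rfl, ← mul_one (C _), ← smul_eq_C_mul]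
        rfl
      · rintro ⟨c, rfl⟩
        refine ⟨C c, isHomogeneous_C _ _, ?_⟩
        rw [← mul_one (C _), ← smul_eq_C_mul]
        rfl
    rw [this, finrank_span_singleton h1, Nat.cast_one]
  · have : quotientPiece (variableIdeal 𝕜 (Finset.univ : Finset (Fin n))) q = ⊥ := by
      rw [eq_bot_iff]
      intro x hx
      obtain ⟨f, hf, rfl⟩ := mem_quotientPiece.1 hx
      rw [Submodule.mem_bot, Ideal.Quotient.eq_zero_iff_mem, mem_variableIdeal]
      intro s hs
      by_contra! h
      have : s = 0 := Finsupp.ext fun x => h x (Finset.mem_univ x)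
      rw [mem_support_iff, this] at hs
      exact hs (hf.coeff_eq_zero (by simpa using Ne.symm hq))
    rw [this, finrank_bot, Nat.cast_zero]

/-- Descending induction on `A` from the set of all variables: multiplication by `x ∉ A` is
injective on the quotient, so adjoining `x` multiplies the series by `1 - t`. -/
theorem gradedHilbertSeries_variableIdeal (A : Finset (Fin n)) {k : ℕ} (hk : A.card + k = n) :
    gradedHilbertSeries (quotientPiece (variableIdeal 𝕜 A)) * (1 - PowerSeries.X) ^ k = 1 := by
  induction k generalizing A with
  | zero =>
    have : A = Finset.univ := Finset.eq_univ_of_card A (by simpa using hk)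
    rw [this, gradedHilbertSeries_variableIdeal_univ, pow_zero, one_mul]
  | succ k ih =>
    obtain ⟨x, hx⟩ : ∃ x, x ∉ A := by
      by_contra! h
      have := Finset.card_eq_iff_eq_univ A |>.2 (Finset.eq_univ_of_forall h)
      rw [Fintype.card_fin] at this
      omega
    have h := (isVariableColon_singleton hx).gradedHilbertSeries_eq (𝕜 := 𝕜)
    rw [← variableIdeal_insert, Finset.card_singleton, pow_one] at h
    have ih' := ih (insert x A) (by rw [Finset.card_insert_of_notMem hx]; omega)
    change gradedHilbertSeries (quotientPiece (variableIdeal 𝕜 A)) = _ at h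
    rw [pow_succ']
    refine Eq.trans ?_ ih'
    linear_combination (1 - PowerSeries.X) ^ k * h

/-- The Hilbert series changes by `|𝓤| t ^ e / (1 - t) ^ k` when squarefree monomials of degree `e`
whose colon ideals are generated by `n - k` variables are added to the generators. -/
theorem gradedHilbertSeries_union {e k : ℕ} (𝓤 : Finset (Finset (Fin n)))
    (hcard : ∀ τ ∈ 𝓤, τ.card = e)
    (h : ∀ τ ∈ 𝓤, ∃ A : Finset (Fin n), A.card + k = n ∧
      (∀ x ∈ A, ∃ σ ∈ 𝓕, σ ⊆ insert x τ) ∧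
      ∀ σ ∈ 𝓕 ∪ 𝓤, σ ≠ τ → ∃ x ∈ σ, x ∉ τ ∧ x ∈ A) (h𝓕 : ∀ τ ∈ 𝓤, τ ∉ 𝓕) :
    gradedHilbertSeries (quotientPiece (squarefreeIdeal 𝕜 𝓕)) * (1 - PowerSeries.X) ^ k =
      gradedHilbertSeries (quotientPiece (squarefreeIdeal 𝕜 (𝓕 ∪ 𝓤))) *
        (1 - PowerSeries.X) ^ k + PowerSeries.C (𝓤.card : ℤ) * PowerSeries.X ^ e := by
  induction 𝓤 using Finset.induction_on with
  | empty => rw [Finset.coe_empty, Set.union_empty]; simp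
  | insert τ 𝓤 hτ ih =>
    rw [ih (fun σ hσ => hcard σ (Finset.mem_insert_of_mem hσ)) ?_
      fun σ hσ => h𝓕 σ (Finset.mem_insert_of_mem hσ)]
    · obtain ⟨A, hA, h1, h2⟩ := h τ (Finset.mem_insert_self _ _)
      -- The order of the additions is irrelevant: `𝓕` alone puts the variables of `A` into the
      -- colon ideal, and the members of `𝓤` already added contribute nothing new.
      have hc : IsVariableColon (𝓕 ∪ 𝓤) τ A := by
        refine ⟨fun x hx => ?_, fun σ hσ => h2 σ ?_ ?_⟩
        · obtain ⟨σ, hσ, hσx⟩ := h1 x hx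
          exact ⟨σ, Or.inl hσ, hσx⟩
        · exact hσ.imp_right fun hσ => by simp [Finset.mem_coe.1 hσ]
        · rintro rfl
          exact hσ.elim (h𝓕 σ (Finset.mem_insert_self _ _)) hτ
      have h3 := hc.gradedHilbertSeries_eq (𝕜 := 𝕜)
      have h4 := gradedHilbertSeries_variableIdeal (𝕜 := 𝕜) A hA
      rw [Finset.coe_insert, Set.union_insert, Finset.card_insert_of_notMem hτ, h3,
        hcard τ (Finset.mem_insert_self _ _)]
      push_cast
      rw [map_add, map_one]
      linear_combination PowerSeries.X ^ e * h4
    · intro σ hσ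
      obtain ⟨A, hA, h1, h2⟩ := h σ (Finset.mem_insert_of_mem hσ)
      refine ⟨A, hA, h1, fun ρ hρ => h2 ρ ?_⟩
      exact hρ.imp_right fun hρ => by simp [Finset.mem_coe.1 hρ]

end Hilbert

/-! ### Heights and associated primes -/

section Height

/-- It is the kernel of the substitution setting the variables of `A` to zero, whose target is a
domain. -/
theorem variableIdeal_isPrime (A : Finset (Fin n)) : (variableIdeal 𝕜 A).IsPrime := by
  classical
  let f : MvPolynomial (Fin n) 𝕜 →ₐ[𝕜] MvPolynomial (Fin n) 𝕜 :=
    aeval fun x => if x ∈ A then 0 else X x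
  have hsub : ∀ p, p - f p ∈ variableIdeal 𝕜 A := by
    intro p
    rw [← Ideal.Quotient.eq]
    have : (Ideal.Quotient.mkₐ 𝕜 (variableIdeal 𝕜 A)) =
        (Ideal.Quotient.mkₐ 𝕜 (variableIdeal 𝕜 A)).comp f := by
      ext x
      simp only [f, AlgHom.comp_apply, aeval_X]
      split_ifs with hx
      · rw [map_zero, Ideal.Quotient.mkₐ_eq_mk, Ideal.Quotient.eq_zero_iff_mem,
          variableIdeal_eq_span]
        exact Ideal.subset_span ⟨x, hx, rfl⟩
      · rfl
    exact DFunLike.congr_fun this p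
  have hker : variableIdeal 𝕜 A = RingHom.ker f := by
    refine le_antisymm ?_ fun p hp => ?_
    · rw [variableIdeal_eq_span, Ideal.span_le]
      rintro _ ⟨x, hx, rfl⟩
      simp [f, Finset.mem_coe.1 hx, RingHom.mem_ker]
    · have := hsub p
      rwa [(RingHom.mem_ker (f := f)).1 hp, sub_zero] at this
  rw [hker]
  exact RingHom.ker_isPrime f

theorem variableIdeal_lt_insert {A : Finset (Fin n)} {x : Fin n} (hx : x ∉ A) :
    variableIdeal 𝕜 A < variableIdeal 𝕜 (insert x A) := by
  refine SetLike.lt_iff_le_and_exists.2 ⟨fun f hf => ?_, X x, ?_, ?_⟩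
  · rw [mem_variableIdeal] at hf ⊢
    intro s hs
    obtain ⟨y, hy, h⟩ := hf s hs
    exact ⟨y, Finset.mem_insert_of_mem hy, h⟩
  · rw [variableIdeal_eq_span]
    exact Ideal.subset_span ⟨x, by simp, rfl⟩
  · rw [mem_variableIdeal]
    intro h
    obtain ⟨y, hy, hne⟩ := h (Finsupp.single x 1) (by simp [mem_support_iff])
    rw [Finsupp.single_apply] at hne
    split_ifs at hne with hxy
    · exact hx (hxy ▸ hy)
    · exact hne rfl

/-- Adjoining the variables one by one gives a strict chain of primes. -/
theorem card_le_height_variableIdeal (A : Finset (Fin n)) :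
    (A.card : ℕ∞) ≤ (variableIdeal 𝕜 A).height := by
  induction A using Finset.induction_on with
  | empty => simp
  | insert x A hx ih =>
    have := variableIdeal_isPrime (𝕜 := 𝕜) A
    have := variableIdeal_isPrime (𝕜 := 𝕜) (insert x A)
    rw [Finset.card_insert_of_notMem hx, Nat.cast_add, Nat.cast_one]
    exact (add_le_add_left ih 1).trans
      (Order.add_one_le_of_lt (Ideal.height_strict_mono_of_isPrime_of_isPrime
        (variableIdeal_lt_insert hx)))

/-- Krull's height theorem. -/
theorem height_variableIdeal_le_card (A : Finset (Fin n)) :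
    (variableIdeal 𝕜 A).height ≤ A.card := by
  refine (Ideal.height_le_spanFinrank _ (variableIdeal_isPrime A).ne_top).trans ?_
  rw [variableIdeal_eq_span]
  refine Nat.cast_le.2 ((Submodule.spanFinrank_span_le_ncard_of_finite
    (A.finite_toSet.image _)).trans ?_)
  exact (Set.ncard_image_le A.finite_toSet).trans (Set.ncard_coe_finset A).le

theorem card_le_height_of_X_mem {P : Ideal (MvPolynomial (Fin n) 𝕜)} {A : Finset (Fin n)}
    (h : ∀ x ∈ A, X x ∈ P) : (A.card : ℕ∞) ≤ P.height := by
  refine (card_le_height_variableIdeal (𝕜 := 𝕜) A).trans (Ideal.height_mono ?_)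
  rw [variableIdeal_eq_span, Ideal.span_le]
  rintro _ ⟨x, hx, rfl⟩
  exact h x hx

theorem exists_X_mem_of_squarefreeIdeal_le {P : Ideal (MvPolynomial (Fin n) 𝕜)} (hP : P.IsPrime)
    (h : squarefreeIdeal 𝕜 𝓕 ≤ P) {σ : Finset (Fin n)} (hσ : σ ∈ 𝓕) : ∃ x ∈ σ, X x ∈ P := by
  have : monomial (squarefreeExponent σ) 1 ∈ P := h (Ideal.subset_span ⟨σ, hσ, rfl⟩)
  rw [monomial_squarefreeExponent] at this
  exact (Ideal.IsPrime.prod_mem_iff).1 this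

/-- The colon ideal is the annihilator of the class of the monomial of `τ`, and it is prime. -/
theorem IsVariableColon.mem_associatedPrimes (h : IsVariableColon 𝓕 τ A) :
    variableIdeal 𝕜 A ∈ associatedPrimes (MvPolynomial (Fin n) 𝕜)
      (MvPolynomial (Fin n) 𝕜 ⧸ squarefreeIdeal 𝕜 𝓕) := by
  refine isAssociatedPrime_iff.2 ⟨variableIdeal_isPrime A,
    Ideal.Quotient.mk _ (monomial (squarefreeExponent τ) 1), ?_⟩
  ext f
  rw [h.mem_iff, Submodule.mem_colon_singleton, Submodule.mem_bot, ← Ideal.Quotient.eq_zero_iff_mem]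
  rfl

theorem le_of_mem_associatedPrimes {R : Type*} [CommRing R] {I P : Ideal R}
    (h : P ∈ associatedPrimes R (R ⧸ I)) : I ≤ P := by
  intro f hf
  obtain ⟨x, hx⟩ := h.2
  rw [hx]
  refine Ideal.le_radical ?_
  obtain ⟨g, rfl⟩ := Ideal.Quotient.mk_surjective x
  rw [Submodule.mem_colon_singleton, Submodule.mem_bot]
  exact Ideal.Quotient.eq_zero_iff_mem.2 (Ideal.mul_mem_right g I hf)

end Height

end SquarefreeMonomialIdeal

/-! ### The ideal `I_Γ(d)` for `d = m + 4` -/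

section Gamma

variable {𝕜 : Type*} [Field 𝕜] {m : ℕ}

/-- The indices of the variables `x₃, …, x_{d-1}`, for `d = m + 4`. -/
def innerVars (m : ℕ) : Finset (Fin (m + 4)) := {x | 2 ≤ x.val ∧ x.val ≤ m + 2}

/-- The indices of the variables `x₂, …, x_{d-1}`, for `d = m + 4`. -/
def outerVars (m : ℕ) : Finset (Fin (m + 4)) := {x | 1 ≤ x.val ∧ x.val ≤ m + 2}

/-- The supports of the quadratic generators of the ideal `I_Γ(d)`. -/
def gammaEdges (U : Finset (Fin (m + 4))) : Set (Finset (Fin (m + 4))) :=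
  (fun j => {0, j}) '' (U : Set (Fin (m + 4)))

/-- The supports of the cubic generators of the ideal `I_Γ(d)`. -/
def gammaCubics (m : ℕ) : Finset (Finset (Fin (m + 4))) := (outerVars m).powersetCard 3

/-- The supports of the generators of the ideal `I_Γ(d)`. -/
def gammaFamily (m : ℕ) : Set (Finset (Fin (m + 4))) :=
  gammaEdges (innerVars m) ∪ gammaCubics m

theorem mem_innerVars {x : Fin (m + 4)} : x ∈ innerVars m ↔ 2 ≤ x.val ∧ x.val ≤ m + 2 := by
  simp [innerVars]

theorem mem_outerVars {x : Fin (m + 4)} : x ∈ outerVars m ↔ 1 ≤ x.val ∧ x.val ≤ m + 2 := by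
  simp [outerVars]

theorem mem_gammaCubics {σ : Finset (Fin (m + 4))} :
    σ ∈ gammaCubics m ↔ (∀ x ∈ σ, 1 ≤ x.val ∧ x.val ≤ m + 2) ∧ σ.card = 3 := by
  rw [gammaCubics, Finset.mem_powersetCard, Finset.subset_iff]
  simp only [mem_outerVars]

theorem card_innerVars : (innerVars m).card = m + 1 := by
  have : innerVars m = Finset.Icc ⟨2, by omega⟩ ⟨m + 2, by omega⟩ := by
    ext x
    simp [mem_innerVars, Fin.le_def]
  rw [this, Fin.card_Icc]
  simp

theorem card_outerVars : (outerVars m).card = m + 2 := by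
  have : outerVars m = Finset.Icc ⟨1, by omega⟩ ⟨m + 2, by omega⟩ := by
    ext x
    simp [mem_outerVars, Fin.le_def]
  rw [this, Fin.card_Icc]
  simp

theorem gammaIdeal_eq : gammaIdeal 𝕜 (m + 4) = squarefreeIdeal 𝕜 (gammaFamily m) := by
  rw [gammaIdeal, squarefreeIdeal, gammaFamily, Set.image_union]
  congr 2
  · ext f
    simp only [Set.mem_ofPred_eq, gammaEdges, Set.image_image, Set.mem_image, Finset.mem_coe,
      mem_innerVars, monomial_squarefreeExponent]
    constructor
    · rintro ⟨i, j, hi, hj, hj', rfl⟩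
      have hi0 : i = 0 := Fin.ext hi
      subst hi0
      refine ⟨j, ⟨hj, by omega⟩, ?_⟩
      rw [Finset.prod_pair]
      rintro rfl
      simp at hj
    · rintro ⟨j, ⟨hj, hj'⟩, rfl⟩
      refine ⟨0, j, rfl, hj, by omega, ?_⟩
      rw [Finset.prod_pair]
      rintro rfl
      simp at hj
  · ext f
    simp only [Set.mem_ofPred_eq, Set.mem_image, Finset.mem_coe, mem_gammaCubics,
      monomial_squarefreeExponent]
    constructor
    · rintro ⟨i, j, k, hi, hij, hjk, hk, rfl⟩
      have hik := hij.trans hjk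
      refine ⟨{i, j, k}, ⟨?_, Finset.card_eq_three.2 ⟨i, j, k, hij.ne, hik.ne, hjk.ne, rfl⟩⟩, ?_⟩
      · simp only [Finset.mem_insert, Finset.mem_singleton]
        rw [Fin.lt_def] at hij hjk
        rintro x (rfl | rfl | rfl) <;> omega
      · rw [Finset.prod_insert (by simp [hij.ne, hik.ne]), Finset.prod_pair hjk.ne, mul_assoc]
    · rintro ⟨σ, ⟨hσ, hcard⟩, rfl⟩
      -- The increasing enumeration of `σ` provides the ordered triple of indices.
      have hm := fun i => hσ _ (σ.orderEmbOfFin_mem hcard i)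
      refine ⟨_, _, _, (hm 0).1, (σ.orderEmbOfFin hcard).strictMono (show (0 : Fin 3) < 1 by decide),
        (σ.orderEmbOfFin hcard).strictMono (show (1 : Fin 3) < 2 by decide), ?_, ?_⟩
      · have := (hm 2).2
        omega
      · conv_lhs => rw [← Finset.map_orderEmbOfFin_univ σ hcard]
        rw [Finset.prod_map, Fin.prod_univ_three]
        rfl

theorem exists_mem_notMem_of_card_lt {α : Type*} {σ τ : Finset α} (h : τ.card < σ.card) :
    ∃ x ∈ σ, x ∉ τ := Finset.exists_mem_notMem_of_card_lt_card h

theorem exists_mem_notMem_of_card_eq {α : Type*} {σ τ : Finset α} (h : τ.card = σ.card)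
    (hne : σ ≠ τ) : ∃ x ∈ σ, x ∉ τ := by
  by_contra! hs
  exact hne (Finset.eq_of_subset_of_card_le hs h.le)

/-! ### Linear quotients of `I_Γ(d)` -/

section Resolution

/-- The colon ideal of the edges `{0, x}`, `x ∈ U`, by the edge `{0, k}` is generated by `U`, so
each edge lengthens the resolution by one. The case `U = ∅` is the zero ideal. -/
theorem hasResolutionType_gammaEdges {U : Finset (Fin (m + 4))} (h0 : 0 ∉ U) :
    HasResolutionType (squarefreeIdeal 𝕜 (gammaEdges U)) U.card (if U = ∅ then 0 else 1) := by
  induction U using Finset.induction_on with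
  | empty =>
    rw [gammaEdges, Finset.coe_empty, Set.image_empty, squarefreeIdeal_empty]
    exact hasResolutionType_bot
  | insert k U hk ih =>
    rw [Finset.mem_insert, not_or] at h0
    have hc : IsVariableColon (gammaEdges U) {0, k} U := by
      refine ⟨fun x hx => ⟨{0, x}, ⟨x, hx, rfl⟩, ?_⟩, ?_⟩
      · intro y
        simp only [Finset.mem_insert, Finset.mem_singleton]
        tauto
      · rintro _ ⟨x, hx, rfl⟩
        refine ⟨x, by simp, ?_, hx⟩
        simp only [Finset.mem_insert, Finset.mem_singleton, not_or]
        exact ⟨fun h => h0.2 (h ▸ hx), fun h => hk (h ▸ hx)⟩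
    have := hc.hasResolutionType_insert (ih h0.2) (hasResolutionType_variableIdeal U) (e := 1)
      (Finset.card_pair h0.1) (by split_ifs <;> omega)
    rw [if_neg (Finset.insert_ne_empty _ _), Finset.card_insert_of_notMem hk, gammaEdges,
      Finset.coe_insert, Set.image_insert_eq]
    rwa [max_eq_right (Nat.le_succ _)] at this

/-- Squarefree cubics have variable colon ideals if they are added in the colexicographic order. -/
theorem isVariableColon_gammaCubics {τ : Finset (Fin (m + 4))} (hτ : τ ∈ gammaCubics m)
    {𝓤 : Finset (Finset (Fin (m + 4)))} (h𝓤 : 𝓤 ⊆ gammaCubics m)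
    (hlt : ∀ σ ∈ 𝓤, toColex σ < toColex τ)
    (hlow : ∀ σ ∈ gammaCubics m, toColex σ < toColex τ → σ ∈ 𝓤) :
    ∃ A : Finset (Fin (m + 4)), A.card ≤ m ∧
      IsVariableColon (gammaEdges (innerVars m) ∪ 𝓤) τ A := by
  obtain ⟨hτm, hτc⟩ := mem_gammaCubics.1 hτ
  have hne : τ.Nonempty := Finset.card_pos.1 (by omega)
  have hmax := τ.max'_mem hne
  -- The colon ideal is generated by the variables below the largest element of `τ` and outside `τ`.
  -- As that element is at most `m + 2`, there are at most `m + 3 - 3` of them.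
  refine ⟨Finset.Iio (τ.max' hne) \ τ, ?_, ?_, ?_⟩
  · have hsub : Finset.Iio (τ.max' hne) \ τ ∪ τ ⊆ Finset.Iic (τ.max' hne) := by
      intro x hx
      rw [Finset.mem_Iic]
      rcases Finset.mem_union.1 hx with hx | hx
      · exact (Finset.mem_Iio.1 (Finset.mem_sdiff.1 hx).1).le
      · exact τ.le_max' x hx
    have := Finset.card_le_card hsub
    rw [Finset.card_union_of_disjoint Finset.sdiff_disjoint, Fin.card_Iic, hτc] at this
    have := (hτm _ hmax).2
    omega
  · intro x hx
    rw [Finset.mem_sdiff, Finset.mem_Iio] at hx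
    by_cases h0 : x = 0
    -- For the variable of index `0`, a cubic has an index other than `1`, which forms an edge with
    -- `0`.
    · obtain ⟨j, hj, hj1⟩ := exists_mem_notMem_of_card_lt (σ := τ) (τ := {1}) (by simp [hτc])
      have := hτm j hj
      have hj1' : j.val ≠ 1 := fun h => hj1 (Finset.mem_singleton.2 (Fin.ext h))
      refine ⟨{0, j}, Or.inl ⟨j, mem_innerVars.2 ⟨by omega, this.2⟩, rfl⟩, ?_⟩
      rw [h0]
      exact Finset.insert_subset_insert _ (Finset.singleton_subset_iff.2 hj)
    -- Otherwise, replacing the maximum of `τ` by the smaller `x` gives a cubic that is earlier in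
    -- colexicographic order.
    · have hx' : x ∉ τ.erase (τ.max' hne) := fun h => hx.2 (Finset.mem_of_mem_erase h)
      refine ⟨insert x (τ.erase (τ.max' hne)), Or.inr (hlow _ (mem_gammaCubics.2 ⟨?_, ?_⟩) ?_),
        Finset.insert_subset_insert _ (Finset.erase_subset _ _)⟩
      · intro y hy
        rcases Finset.mem_insert.1 hy with rfl | hy
        · have h1 := (hτm _ hmax).2
          have h2 : y.val ≠ 0 := fun h => h0 (Fin.ext h)
          have h3 := Fin.lt_def.1 hx.1
          omega
        · exact hτm y (Finset.mem_of_mem_erase hy)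
      · rw [Finset.card_insert_of_notMem hx', Finset.card_erase_of_mem hmax, hτc]
      · rw [Finset.Colex.toColex_lt_toColex]
        refine ⟨fun h => hx.2 (h ▸ Finset.mem_insert_self _ _), fun a ha ha' => ?_⟩
        rcases Finset.mem_insert.1 ha with rfl | ha
        · refine ⟨_, hmax, ?_, hx.1.le⟩
          rw [Finset.mem_insert, not_or]
          exact ⟨hx.1.ne', Finset.notMem_erase _ _⟩
        · exact absurd (Finset.mem_of_mem_erase ha) ha'
  · rintro σ (⟨j, hj, rfl⟩ | hσ)
    · have h0 : (0 : Fin (m + 4)) ∉ τ := fun h => absurd (hτm _ h).1 (by simp)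
      refine ⟨0, by simp, h0, Finset.mem_sdiff.2 ⟨Finset.mem_Iio.2 ?_, h0⟩⟩
      exact Fin.lt_def.2 (hτm _ hmax).1
    · have hσc := (mem_gammaCubics.1 (h𝓤 hσ)).2
      obtain ⟨hne', hcolex⟩ := Finset.Colex.toColex_lt_toColex.1 (hlt σ hσ)
      obtain ⟨x, hx, hxτ⟩ := exists_mem_notMem_of_card_eq (hτc.trans hσc.symm) hne'
      -- An earlier cubic has each element outside `τ` bounded by some element of `τ`, hence below
      -- the maximum of `τ`.
      obtain ⟨b, hb, -, hxb⟩ := hcolex hx hxτ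
      refine ⟨x, hx, hxτ, Finset.mem_sdiff.2 ⟨Finset.mem_Iio.2 ?_, hxτ⟩⟩
      refine lt_of_le_of_ne (hxb.trans (τ.le_max' b hb)) ?_
      rintro rfl
      exact hxτ hmax

/-- `𝓤` runs through the colexicographic initial segments. The length stays `m + 1`, since the
Koszul complex of each colon ideal has length at most `m`. -/
theorem hasResolutionType_union_gammaCubics (𝓤 : Finset (Finset (Fin (m + 4))))
    (h𝓤 : 𝓤 ⊆ gammaCubics m)
    (hlow : ∀ τ ∈ 𝓤, ∀ σ ∈ gammaCubics m, toColex σ < toColex τ → σ ∈ 𝓤) :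
    HasResolutionType (squarefreeIdeal 𝕜 (gammaEdges (innerVars m) ∪ 𝓤)) (m + 1)
      (if 𝓤 = ∅ then 1 else 2) := by
  revert h𝓤 hlow
  refine Finset.induction_on_max_value (fun σ : Finset (Fin (m + 4)) => toColex σ) 𝓤 ?_ ?_
  · intro _ _
    have h0 : (0 : Fin (m + 4)) ∉ innerVars m := fun h => absurd (mem_innerVars.1 h).1 (by simp)
    have := hasResolutionType_gammaEdges (𝕜 := 𝕜) h0
    rw [if_neg, card_innerVars] at this
    · rwa [Finset.coe_empty, Set.union_empty]
    · exact (Finset.card_pos.1 (by rw [card_innerVars]; omega)).ne_empty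
  · intro τ 𝓤 hτ hmax ih h𝓤 hlow
    have hlt : ∀ σ ∈ 𝓤, toColex σ < toColex τ := fun σ hσ =>
      lt_of_le_of_ne (hmax σ hσ) fun h => hτ (toColex_inj.1 h ▸ hσ)
    obtain ⟨hτ', h𝓤'⟩ := Finset.insert_subset_iff.1 h𝓤
    have hlow' : ∀ σ ∈ gammaCubics m, toColex σ < toColex τ → σ ∈ 𝓤 := fun σ hσ hστ =>
      Finset.mem_of_mem_insert_of_ne (hlow τ (Finset.mem_insert_self _ _) σ hσ hστ) (by
        rintro rfl
        exact lt_irrefl _ hστ)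
    obtain ⟨A, hA, hc⟩ := isVariableColon_gammaCubics hτ' h𝓤' hlt hlow'
    have := hc.hasResolutionType_insert
      (ih h𝓤' fun ρ hρ σ hσ hσρ => hlow' σ hσ (hσρ.trans (hlt ρ hρ)))
      (hasResolutionType_variableIdeal A) (e := 2) (mem_gammaCubics.1 hτ').2
      (by split_ifs <;> omega)
    rw [if_neg (Finset.insert_ne_empty _ _), Finset.coe_insert, Set.union_insert]
    rwa [max_eq_left (by omega)] at this

theorem hasResolutionType_gammaFamily :
    HasResolutionType (squarefreeIdeal 𝕜 (gammaFamily m)) (m + 1)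
      (if gammaCubics m = ∅ then 1 else 2) :=
  hasResolutionType_union_gammaCubics _ subset_rfl fun _ _ _ hσ _ => hσ

end Resolution

/-! ### Codimension -/

section Codimension

theorem isVariableColon_gammaFamily :
    IsVariableColon (gammaFamily m) {0, 1} (innerVars m) := by
  have key : ∀ x : Fin (m + 4), 2 ≤ x.val → x ∉ ({0, 1} : Finset (Fin (m + 4))) := by
    intro x hx h
    rcases Finset.mem_insert.1 h with rfl | h
    · simp at hx
    · rw [Finset.mem_singleton.1 h] at hx
      simp at hx
  refine ⟨fun x hx => ⟨{0, x}, Or.inl ⟨x, hx, rfl⟩, ?_⟩, ?_⟩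
  · intro y
    simp only [Finset.mem_insert, Finset.mem_singleton]
    tauto
  · rintro σ (⟨j, hj, rfl⟩ | hσ)
    · exact ⟨j, by simp, key j (mem_innerVars.1 hj).1, hj⟩
    · obtain ⟨hσ, hc⟩ := mem_gammaCubics.1 hσ
      obtain ⟨x, hx, hx1⟩ := exists_mem_notMem_of_card_lt (σ := σ) (τ := {1}) (by simp [hc])
      have := hσ x hx
      have hx1' : x.val ≠ 1 := fun h => hx1 (Finset.mem_singleton.2 (Fin.ext h))
      have hx2 : 2 ≤ x.val := by omega
      exact ⟨x, hx, key x hx2, mem_innerVars.2 ⟨hx2, this.2⟩⟩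

/-- If `X 0 ∈ P`, then `P` misses at most two outer variables, as three of them would form a cubic
generator without a factor in `P`; so `P` contains `1 + m` variables. If `X 0 ∉ P`, the edges force
all `m + 1` inner variables into `P`. -/
theorem le_height_of_squarefreeIdeal_gammaFamily_le {P : Ideal (MvPolynomial (Fin (m + 4)) 𝕜)}
    (hP : P.IsPrime) (h : squarefreeIdeal 𝕜 (gammaFamily m) ≤ P) :
    ((m + 1 : ℕ) : ℕ∞) ≤ P.height := by
  classical
  by_cases h0 : X 0 ∈ P
  · let V : Finset (Fin (m + 4)) := (outerVars m).filter fun x => X x ∈ P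
    have hV : (outerVars m \ V).card ≤ 2 := by
      by_contra! hlt
      obtain ⟨σ, hσ, hσc⟩ := Finset.exists_subset_card_eq (show 3 ≤ _ from hlt)
      have hσ' : σ ∈ gammaCubics m :=
        Finset.mem_powersetCard.2 ⟨hσ.trans Finset.sdiff_subset, hσc⟩
      obtain ⟨x, hx, hxP⟩ := exists_X_mem_of_squarefreeIdeal_le hP h (Or.inr hσ')
      obtain ⟨hx1, hx2⟩ := Finset.mem_sdiff.1 (hσ hx)
      exact hx2 (Finset.mem_filter.2 ⟨hx1, hxP⟩)
    have h0V : (0 : Fin (m + 4)) ∉ V := fun h =>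
      absurd (mem_outerVars.1 (Finset.mem_filter.1 h).1).1 (by simp)
    have hle := card_le_height_of_X_mem (P := P) (A := insert 0 V) (by
      intro x hx
      rcases Finset.mem_insert.1 hx with rfl | hx
      · exact h0
      · exact (Finset.mem_filter.1 hx).2)
    refine le_trans (Nat.cast_le.2 ?_) hle
    rw [Finset.card_insert_of_notMem h0V]
    have := Finset.card_sdiff_add_card_eq_card (s := V) (t := outerVars m)
      (Finset.filter_subset _ _)
    rw [card_outerVars] at this
    omega
  · rw [← card_innerVars]
    refine card_le_height_of_X_mem fun x hx => ?_
    obtain ⟨y, hy, hyP⟩ := exists_X_mem_of_squarefreeIdeal_le hP h (Or.inl ⟨x, hx, rfl⟩)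
    rcases Finset.mem_insert.1 hy with rfl | hy
    · exact absurd hyP h0
    · rwa [← Finset.mem_singleton.1 hy]

theorem moduleCodim_gammaFamily :
    moduleCodim (MvPolynomial (Fin (m + 4)) 𝕜)
      (MvPolynomial (Fin (m + 4)) 𝕜 ⧸ squarefreeIdeal 𝕜 (gammaFamily m)) = (m + 1 : ℕ) := by
  refine le_antisymm ?_ (le_iInf₂ fun P hP => ?_)
  · refine (iInf₂_le _ isVariableColon_gammaFamily.mem_associatedPrimes).trans ?_
    exact (height_variableIdeal_le_card _).trans_eq (by rw [card_innerVars])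
  · exact le_height_of_squarefreeIdeal_gammaFamily_le hP.1 (le_of_mem_associatedPrimes hP)

end Codimension

/-! ### Hilbert series -/

section HilbertSeries

theorem card_compl_triple {a b c : Fin (m + 4)} (hab : a ≠ b) (hac : a ≠ c) (hbc : b ≠ c) :
    ({a, b, c}ᶜ : Finset (Fin (m + 4))).card + 3 = m + 4 := by
  rw [Finset.card_compl, Fintype.card_fin, Finset.card_eq_three.2 ⟨a, b, c, hab, hac, hbc, rfl⟩]
  omega

theorem val_le_of_ne_last {x : Fin (m + 4)} (hx : x ≠ Fin.last _) : x.val ≤ m + 2 := by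
  have := x.2
  have : x.val ≠ m + 3 := fun h => hx (Fin.ext h)
  omega

theorem ne_last_of_le {x : Fin (m + 4)} (hx : x.val ≤ m + 2) : x ≠ Fin.last _ := by
  rintro rfl
  simp at hx

theorem gradedHilbertSeries_gammaFamily_pairs :
    gradedHilbertSeries (quotientPiece (squarefreeIdeal 𝕜 (gammaFamily m))) *
        (1 - PowerSeries.X) ^ 3 =
      gradedHilbertSeries (quotientPiece (squarefreeIdeal 𝕜
        (gammaFamily m ∪ (innerVars m).powersetCard 2))) * (1 - PowerSeries.X) ^ 3 +
        PowerSeries.C (((m + 1).choose 2 : ℕ) : ℤ) * PowerSeries.X ^ 2 := by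
  rw [← card_innerVars (m := m), ← Finset.card_powersetCard]
  refine gradedHilbertSeries_union _ (fun τ hτ => (Finset.mem_powersetCard.1 hτ).2) ?_ ?_
  · intro τ hτ
    obtain ⟨hτm, hτc⟩ := Finset.mem_powersetCard.1 hτ
    obtain ⟨i, j, hij, rfl⟩ := Finset.card_eq_two.1 hτc
    obtain ⟨hi, hi'⟩ := mem_innerVars.1 (hτm (by simp : i ∈ _))
    obtain ⟨hj, hj'⟩ := mem_innerVars.1 (hτm (by simp : j ∈ _))
    have hA : ∀ x : Fin (m + 4), x ∈ ({i, j, Fin.last _}ᶜ : Finset (Fin (m + 4))) ↔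
        x ∉ ({i, j} : Finset (Fin (m + 4))) ∧ x ≠ Fin.last _ := by
      intro x
      simp only [Finset.mem_compl, Finset.mem_insert, Finset.mem_singleton, not_or]
      tauto
    -- The last variable occurs in no generator. Every other one outside `{i, j}` is in the colon
    -- ideal: index `0` through an edge, the rest through a cubic.
    refine ⟨{i, j, Fin.last _}ᶜ, card_compl_triple hij (ne_last_of_le hi') (ne_last_of_le hj'),
      ?_, ?_⟩
    · intro x hx
      rw [hA] at hx
      by_cases h0 : x = 0
      · refine ⟨{0, i}, Or.inl ⟨i, hτm (by simp), rfl⟩, ?_⟩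
        rw [h0]
        exact Finset.insert_subset_insert _ (by simp)
      · refine ⟨insert x {i, j}, Or.inr (mem_gammaCubics.2 ⟨?_, ?_⟩), subset_rfl⟩
        · intro y hy
          simp only [Finset.mem_insert, Finset.mem_singleton] at hy
          have h1 := val_le_of_ne_last hx.2
          have h2 : x.val ≠ 0 := fun h => h0 (Fin.ext h)
          rcases hy with rfl | rfl | rfl <;> omega
        · rw [Finset.card_insert_of_notMem hx.1, hτc]
    · rintro σ ((⟨x, hx, rfl⟩ | hσ) | hσ) hne
      · refine ⟨0, by simp, ?_⟩
        have h0 : (0 : Fin (m + 4)) ∉ ({i, j} : Finset (Fin (m + 4))) := fun h =>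
          absurd (mem_innerVars.1 (hτm h)).1 (by simp)
        exact ⟨h0, (hA 0).2 ⟨h0, ne_last_of_le (by simp)⟩⟩
      · obtain ⟨hσm, hσc⟩ := mem_gammaCubics.1 hσ
        obtain ⟨x, hx, hxτ⟩ := exists_mem_notMem_of_card_lt (σ := σ) (τ := {i, j}) (by omega)
        exact ⟨x, hx, hxτ, (hA x).2 ⟨hxτ, ne_last_of_le (hσm x hx).2⟩⟩
      · obtain ⟨hσm, hσc⟩ := Finset.mem_powersetCard.1 hσ
        obtain ⟨x, hx, hxτ⟩ := exists_mem_notMem_of_card_eq (hτc.trans hσc.symm) hne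
        exact ⟨x, hx, hxτ, (hA x).2 ⟨hxτ, ne_last_of_le (mem_innerVars.1 (hσm hx)).2⟩⟩
  · intro τ hτ
    obtain ⟨hτm, hτc⟩ := Finset.mem_powersetCard.1 hτ
    rintro (⟨x, hx, rfl⟩ | h)
    · exact absurd (mem_innerVars.1 (hτm (Finset.mem_insert_self _ _))).1 (by simp)
    · have := (mem_gammaCubics.1 h).2
      omega

theorem gradedHilbertSeries_gammaFamily_singletons :
    gradedHilbertSeries (quotientPiece (squarefreeIdeal 𝕜
        (gammaFamily m ∪ (innerVars m).powersetCard 2))) * (1 - PowerSeries.X) ^ 3 =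
      gradedHilbertSeries (quotientPiece (squarefreeIdeal 𝕜
        (gammaFamily m ∪ (innerVars m).powersetCard 2 ∪ (innerVars m).powersetCard 1))) *
          (1 - PowerSeries.X) ^ 3 + PowerSeries.C ((m + 1 : ℕ) : ℤ) * PowerSeries.X ^ 1 := by
  rw [← card_innerVars (m := m), ← Nat.choose_one_right (innerVars m).card,
    ← Finset.card_powersetCard]
  refine gradedHilbertSeries_union _ (fun τ hτ => (Finset.mem_powersetCard.1 hτ).2) ?_ ?_
  · intro τ hτ
    obtain ⟨hτm, hτc⟩ := Finset.mem_powersetCard.1 hτ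
    obtain ⟨j, rfl⟩ := Finset.card_eq_one.1 hτc
    have hj := hτm (Finset.mem_singleton_self j)
    obtain ⟨hj2, hjm⟩ := mem_innerVars.1 hj
    have h1j : (1 : Fin (m + 4)) ≠ j := by
      rintro rfl
      simp at hj2
    have hA : ∀ x : Fin (m + 4), x ∈ ({1, j, Fin.last _}ᶜ : Finset (Fin (m + 4))) ↔
        x ≠ 1 ∧ x ≠ j ∧ x ≠ Fin.last _ := by
      intro x
      simp only [Finset.mem_compl, Finset.mem_insert, Finset.mem_singleton, not_or]
    -- Now index `1` is omitted too: a cubic containing it still has an inner variable different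
    -- from `j`, so the pairs and the edges already account for the whole colon ideal.
    refine ⟨{1, j, Fin.last _}ᶜ, card_compl_triple h1j (ne_last_of_le (by simp))
      (ne_last_of_le hjm), ?_, ?_⟩
    · intro x hx
      rw [hA] at hx
      by_cases h0 : x = 0
      · exact ⟨{0, j}, Or.inl (Or.inl ⟨j, hj, rfl⟩), by rw [h0]⟩
      · refine ⟨{x, j}, Or.inr (Finset.mem_powersetCard.2
          ⟨Finset.insert_subset ?_ hτm, Finset.card_pair hx.2.1⟩), subset_rfl⟩
        have h1 : x.val ≠ 0 := fun h => h0 (Fin.ext h)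
        have h2 : x.val ≠ 1 := fun h => hx.1 (Fin.ext h)
        exact mem_innerVars.2 ⟨by omega, val_le_of_ne_last hx.2.2⟩
    · have inner : ∀ x ∈ innerVars m, x ≠ j → x ∉ ({j} : Finset (Fin (m + 4))) ∧
          x ∈ ({1, j, Fin.last _}ᶜ : Finset (Fin (m + 4))) := by
        intro x hx hxj
        obtain ⟨h2, hm⟩ := mem_innerVars.1 hx
        refine ⟨by simpa using hxj, (hA x).2 ⟨?_, hxj, ne_last_of_le hm⟩⟩
        rintro rfl
        simp at h2
      rintro σ (((⟨x, hx, rfl⟩ | hσ) | hσ) | hσ) hne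
      · have h0 : (0 : Fin (m + 4)) ≠ j := by
          rintro rfl
          simp at hj2
        exact ⟨0, by simp, by simpa using h0, (hA 0).2 ⟨by simp, h0, ne_last_of_le (by simp)⟩⟩
      · obtain ⟨hσm, hσc⟩ := mem_gammaCubics.1 hσ
        obtain ⟨x, hx, hxτ⟩ := exists_mem_notMem_of_card_lt (σ := σ) (τ := {1, j})
          (by rw [Finset.card_pair h1j]; omega)
        simp only [Finset.mem_insert, Finset.mem_singleton, not_or] at hxτ
        have := hσm x hx
        have h2 : x.val ≠ 1 := fun h => hxτ.1 (Fin.ext h)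
        exact ⟨x, hx, inner x (mem_innerVars.2 ⟨by omega, this.2⟩) hxτ.2⟩
      · obtain ⟨hσm, hσc⟩ := Finset.mem_powersetCard.1 hσ
        obtain ⟨x, hx, hxτ⟩ := exists_mem_notMem_of_card_lt (σ := σ) (τ := {j}) (by simp [hσc])
        exact ⟨x, hx, inner x (hσm hx) (by simpa using hxτ)⟩
      · obtain ⟨hσm, hσc⟩ := Finset.mem_powersetCard.1 hσ
        obtain ⟨x, hx, hxτ⟩ := exists_mem_notMem_of_card_eq (hτc.trans hσc.symm) hne
        exact ⟨x, hx, inner x (hσm hx) (by simpa using hxτ)⟩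
  · intro τ hτ
    obtain ⟨hτm, hτc⟩ := Finset.mem_powersetCard.1 hτ
    rintro ((⟨x, hx, rfl⟩ | h) | h)
    · exact absurd (mem_innerVars.1 (hτm (Finset.mem_insert_self _ _))).1 (by simp)
    · have := (mem_gammaCubics.1 h).2
      omega
    · have := (Finset.mem_powersetCard.1 h).2
      omega

/-- Every generator, old or new, is divisible by an inner variable, and the sets of size one are the
inner variables themselves. -/
theorem squarefreeIdeal_gammaFamily_union :
    squarefreeIdeal 𝕜 (gammaFamily m ∪ (innerVars m).powersetCard 2 ∪
      (innerVars m).powersetCard 1) = variableIdeal 𝕜 (innerVars m) := by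
  have hmem : ∀ x ∈ innerVars m, ({x} : Finset (Fin (m + 4))) ∈ (innerVars m).powersetCard 1 :=
    fun x hx => Finset.mem_powersetCard.2 ⟨by simpa using hx, rfl⟩
  refine squarefreeIdeal_eq_of_subset ?_ ?_
  · rintro _ ⟨x, hx, rfl⟩
    exact Or.inr (hmem x hx)
  · have key : ∀ σ : Finset (Fin (m + 4)), (∃ x ∈ σ, x ∈ innerVars m) →
        ∃ ρ ∈ (fun x => {x}) '' (innerVars m : Set (Fin (m + 4))), ρ ⊆ σ := by
      rintro σ ⟨x, hx, hxm⟩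
      exact ⟨{x}, ⟨x, hxm, rfl⟩, by simpa using hx⟩
    have key' : ∀ k, ∀ σ ∈ (innerVars m).powersetCard (k + 1), ∃ x ∈ σ, x ∈ innerVars m := by
      intro k σ hσ
      obtain ⟨hσm, hσc⟩ := Finset.mem_powersetCard.1 hσ
      obtain ⟨x, hx⟩ := Finset.card_pos.1 (by omega : 0 < σ.card)
      exact ⟨x, hx, hσm hx⟩
    rintro σ ((hσ | hσ) | hσ)
    · obtain ⟨x, hx, -, hxm⟩ := isVariableColon_gammaFamily.exists_mem σ hσ
      exact key σ ⟨x, hx, hxm⟩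
    · exact key σ (key' 1 σ hσ)
    · exact key σ (key' 0 σ hσ)

theorem gradedHilbertSeries_gammaFamily :
    gradedHilbertSeries (quotientPiece (squarefreeIdeal 𝕜 (gammaFamily m))) *
        (1 - PowerSeries.X) ^ 3 =
      1 + PowerSeries.C ((m + 1 : ℕ) : ℤ) * PowerSeries.X +
        PowerSeries.C (((m + 1).choose 2 : ℕ) : ℤ) * PowerSeries.X ^ 2 := by
  rw [gradedHilbertSeries_gammaFamily_pairs, gradedHilbertSeries_gammaFamily_singletons,
    squarefreeIdeal_gammaFamily_union,
    gradedHilbertSeries_variableIdeal _ (by rw [card_innerVars]), pow_one]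

end HilbertSeries

end Gamma

theorem theorem5p7 (𝕜 : Type*) [Field 𝕜] (d : ℕ) (hd : 4 ≤ d) :
    IsGradedCohenMacaulay d (quotientPiece (gammaIdeal 𝕜 d)) ∧
    (5 ≤ d → HasRegularity d (quotientPiece (gammaIdeal 𝕜 d)) 2) ∧
    gradedHilbertSeries (quotientPiece (gammaIdeal 𝕜 d)) * (1 - PowerSeries.X) ^ 3 =
      1 + PowerSeries.C ((d : ℤ) - 3) * PowerSeries.X +
        PowerSeries.C (((d - 3).choose 2 : ℕ) : ℤ) * PowerSeries.X ^ 2 := by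
  obtain ⟨m, rfl⟩ := Nat.exists_eq_add_of_le' hd
  rw [gammaIdeal_eq]
  obtain ⟨F, hF⟩ := hasResolutionType_gammaFamily (𝕜 := 𝕜) (m := m)
  refine ⟨⟨m + 1, hF.hasProjDim, moduleCodim_gammaFamily⟩, fun hm => ?_, ?_⟩
  · have hne : gammaCubics m ≠ ∅ := by
      refine (Finset.card_pos.1 ?_).ne_empty
      rw [gammaCubics, Finset.card_powersetCard, card_outerVars]
      -- A cubic exists exactly when `m + 2 ≥ 3`, which is `5 ≤ d`.
      exact Nat.choose_pos (by omega)
    rw [if_neg hne] at hF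
    exact hF.hasRegularity
  · rw [gradedHilbertSeries_gammaFamily, show m + 4 - 3 = m + 1 by omega,
      show ((m + 4 : ℕ) : ℤ) - 3 = ((m + 1 : ℕ) : ℤ) by push_cast; ring]
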